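/- **Setting.** Let $d\ge 2$. A fully connected ReLU network with $d$ layers of widths $h_0,h_1,\dots,h_d$ is a parameter $\theta=(A_1,\dots,A_d)\in\Theta=\mathbb R^{h_1\times h_0}\times\cdots\times\mathbb R^{h_d\times h_{d-1}}$. With $\phi$ the coordinatewise ReLU, an input $x$ gives the vectors before activation $x^0=x$, $x^1=A_1x^0$, $x^i=A_i\phi(x^{i-1})$ for $2\le i\le d$, and $f_\theta(x)=x^d$. For $1\le i\le j\le d$ let $M^{i,j}$ be the composition of the layers $i+1,\dots,j$ (so $x^j=M^{i,j}(x^i)$) and $J^{i,j}_{x^i}$ its Jacobian at $x^i$. Let $S\subset\mathbb R^{h_0}\times\mathbb R^{h_d}$ be a finite non-empty sample and $L(f_\theta)=\frac1{|S|}\sum_{(x,y)\in S}l(y,f_\theta(x))$, where $l(y,\hat y)$ is convex and $\beta$-Lipschitz in $\hat y$. Norms of vectors are $\ell_2$ norms, $\|\cdot\|$ of a matrix is the operator norm, $\|\cdot\|_F$ the Frobenius norm; $h_{\min}=\min_{1\le i\le d-1}h_i$; "$x\in S$" ranges over the inputs in $S$. **Noise stability quantities.** $$\mu_i=\min_{x\in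 S}\frac{\|A_i\phi(x^{i-1})\|}{\|A_i\|_F\|\phi(x^{i-1})\|},\qquad \mu_{i,j}=\min_{x\in S}\frac{\|J^{i,j}_{x^i}x^i\|}{\|J^{i,j}_{x^i}\|\,\|x^i\|},\qquad \mu_{i\to}=\min_{i\le j\le d}\mu_{i,j},\qquad c=\max_{x\in S,\,1\le i\le d-1}\frac{\|x^i\|}{\|\phi(x^i)\|}$$ (layer cushion, interlayer cushion, minimal interlayer cushion, activation contraction). **Dropout.** Let $p=3/4$. Independently for every $2\le i\le d$ and every column of $A_i$, multiply this column by $0$ with probability $p$ and by $\frac1{1-p}$ with probability $1-p$; this gives $\hat A_i$. Put $\theta^i=(A_1,\hat A_2,\dots,\hat A_i,A_{i+1},\dots,A_d)$ (so $\theta^1=\theta$), and for $0\le t\le1$ let $\hat x^i_m(t)$ be the vector before activation at layer $i$, on input $x$, of the network $t\theta+(1-t)\theta^m$. **Definition.** Let $K$ be a constant. The network $\theta$ is $\epsilon$-noise stable (with constant $K$) if $\min_{2\le i\le d}\mu_i\mu_{i\to}$ is well defined (all Jacobians in it exist and all denominators are nonzero) and positive; for some $\rho\ge 3d$ the following hold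 simultaneously with probability at least $1/2$ over the dropout: * (interlayer smoothness $\rho$) for all $2\le i\le j\le d$, $x\in S$, $0\le t\le 1$, both for $\hat x=\hat x^i_i(t)$ and for $\hat x=\hat x^i_{i-1}(t)$, $$\|M^{i,j}(\hat x)-J^{i,j}_{x^i}\hat x\|\le\frac{\|\hat x-x^i\|\,\|x^j\|}{\rho\,\|x^i\|};$$ * for all $1\le i\le d-1$, $x\in S$, $0\le t\le1$: $\ \|\phi(\hat x^i_i(t))\|_\infty\le\frac{K}{\sqrt{h_i}}\|\phi(\hat x^i_i(t))\|$; and $$\frac{\beta\,c\,d^{3/2}\max_{x\in S}\|f_\theta(x)\|}{h_{\min}^{1/2}\,\min_{2\le i\le d}(\mu_i\mu_{i\to})}\le\epsilon .$$ **Theorem.** There is an absolute $k\in\mathbb N$, and for every $K$ a constant $C$ depending only on $K$, such that the following holds for all $d\ge2$, all widths, samples $S$, constants $\beta$, losses $l$ as above and all $\epsilon$. If $\theta^A$ and $\theta^B$ are both $\epsilon$-noise stable (with constant $K$), then there is a continuous path $\pi:[0,1]\to\Theta$ from $\theta^A$ to $\theta^B$ consisting of $10$ line segments such that for all $0\le t\le1$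 $$L(f_{\pi(t)})\le\max\{L(f_{\theta^A}),L(f_{\theta^B})\}+C\,\log\Bigl(2+|S|+d+\sum_{i=1}^d h_i\Bigr)^{k}\,\epsilon .$$ -/

import Mathlib

open Set MeasureTheory

noncomputable section

namespace NoiseStability

/-- Euclidean space `ℝⁿ`, with the `ℓ²` norm. -/
abbrev Vec (n : ℕ) : Type := EuclideanSpace ℝ (Fin n)

/-- The parameter space of fully connected networks with `d` layers and widths `h 0, …, h d`:
`θ n` is the weight matrix `A_{n+1} ∈ ℝ^{h (n+1) × h n}` of layer `n + 1`, for `0 ≤ n < d`. -/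
abbrev Params (d : ℕ) (h : ℕ → ℕ) : Type :=
  (n : Fin d) → Matrix (Fin (h (n.val + 1))) (Fin (h n.val)) ℝ

/-- The coordinatewise ReLU activation `φ`. -/
def relu {n : ℕ} (v : Vec n) : Vec n := WithLp.toLp 2 fun a => max (v a) 0

/-- The matrix-vector product, as a vector of Euclidean space. -/
def apply {m n : ℕ} (A : Matrix (Fin m) (Fin n) ℝ) (v : Vec n) : Vec m :=
  WithLp.toLp 2 (A.mulVec (WithLp.ofLp v))

/-- The Frobenius norm. -/
def frobeniusNorm {m n : ℕ} (A : Matrix (Fin m) (Fin n) ℝ) : ℝ :=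
  Real.sqrt (∑ a, ∑ b, A a b ^ 2)

section Network

variable {d : ℕ} {h : ℕ → ℕ}

/-- The weight matrix `A_{n+1}` of layer `n + 1`, indexed by natural numbers `n`
(the value `0` for `n ≥ d` is never used). -/
def weight (θ : Params d h) (n : ℕ) : Matrix (Fin (h (n + 1))) (Fin (h n)) ℝ :=
  if hn : n < d then θ ⟨n, hn⟩ else 0

/-- The vector `x^i` before activation at layer `i` on input `x`:
`x^0 = x`, `x^1 = A_1 x^0`, and `x^i = A_i φ(x^{i-1})` for `i ≥ 2`. -/
def preact (θ : Params d h) (x : Vec (h 0)) : (i : ℕ) → Vec (h i)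
  | 0 => x
  | 1 => apply (weight θ 0) x
  | n + 2 => apply (weight θ (n + 1)) (relu (preact θ x (n + 1)))

/-- The function `f_θ` computed by the network: the output is `x^d`. -/
def output (θ : Params d h) (x : Vec (h 0)) : Vec (h d) := preact θ x d

/-- The composition `M^{i,j}` of the layers `i + 1, …, j`, where `j = i + k` and `i ≥ 1`,
so that `x^j = M^{i,j}(x^i)`. -/
def layers (θ : Params d h) (i : ℕ) : (k : ℕ) → Vec (h i) → Vec (h (i + k))
  | 0 => fun v => v
  | k + 1 => fun v => apply (weight θ (i + k)) (relu (layers θ i k v))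

/-- The Jacobian `J^{i,j}_{x^i}` of `M^{i,j}` at `x^i`, where `j = i + k`. As a continuous linear
map its norm is the spectral norm. -/
def jacobian (θ : Params d h) (x : Vec (h 0)) (i k : ℕ) : Vec (h i) →L[ℝ] Vec (h (i + k)) :=
  fderiv ℝ (layers θ i k) (preact θ x i)

/-- The empirical loss `L(f_θ) = (1/|S|) ∑_{(x,y) ∈ S} l(y, f_θ(x))`. -/
def loss (l : Vec (h d) → Vec (h d) → ℝ) (S : Finset (Vec (h 0) × Vec (h d)))
    (θ : Params d h) : ℝ :=
  (S.card : ℝ)⁻¹ * ∑ z ∈ S, l z.2 (output θ z.1)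

/-! ### Noise stability quantities -/

/-- The layer cushion `μ_{n+1}` of layer `n + 1`, for `n ≥ 1`:
the minimum over the sample of `‖A_{n+1} φ(x^n)‖ / (‖A_{n+1}‖_F ‖φ(x^n)‖)`. -/
def layerCushion (θ : Params d h) (S : Finset (Vec (h 0) × Vec (h d))) (n : ℕ) : ℝ :=
  ⨅ z : S, ‖apply (weight θ n) (relu (preact θ z.1.1 n))‖ /
    (frobeniusNorm (weight θ n) * ‖relu (preact θ z.1.1 n)‖)

/-- The interlayer cushion `μ_{i,j}`, where `j = i + k`: the minimum over the sample of
`‖J^{i,j}_{x^i} x^i‖ / (‖J^{i,j}_{x^i}‖ ‖x^i‖)`. -/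
def interlayerCushion (θ : Params d h) (S : Finset (Vec (h 0) × Vec (h d))) (i k : ℕ) : ℝ :=
  ⨅ z : S, ‖jacobian θ z.1.1 i k (preact θ z.1.1 i)‖ /
    (‖jacobian θ z.1.1 i k‖ * ‖preact θ z.1.1 i‖)

/-- The minimal interlayer cushion `μ_{i→} = min_{i ≤ j ≤ d} μ_{i,j}` of a layer `i ≤ d`. -/
def minInterlayerCushion (θ : Params d h) (S : Finset (Vec (h 0) × Vec (h d))) (i : ℕ) : ℝ :=
  ⨅ k : Fin (d - i + 1), interlayerCushion θ S i k.val

/-- `min_{2 ≤ i ≤ d} μ_i μ_{i→}` (here `i = n + 2`). -/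
def minCushion (θ : Params d h) (S : Finset (Vec (h 0) × Vec (h d))) : ℝ :=
  ⨅ n : Fin (d - 1), layerCushion θ S (n.val + 1) * minInterlayerCushion θ S (n.val + 2)

/-- The activation contraction `c = max_{x ∈ S, 1 ≤ i ≤ d - 1} ‖x^i‖ / ‖φ(x^i)‖`
(here `i = n + 1`). -/
def activationContraction (θ : Params d h) (S : Finset (Vec (h 0) × Vec (h d))) : ℝ :=
  ⨆ q : S × Fin (d - 1), ‖preact θ q.1.1.1 (q.2.val + 1)‖ / ‖relu (preact θ q.1.1.1 (q.2.val + 1))‖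

/-- `max_{x ∈ S} ‖f_θ(x)‖`. -/
def maxOutput (θ : Params d h) (S : Finset (Vec (h 0) × Vec (h d))) : ℝ :=
  ⨆ z : S, ‖output θ z.1.1‖

/-- The minimum width `h_min` of the hidden layers `1, …, d - 1`. -/
def minWidth (d : ℕ) (h : ℕ → ℕ) : ℕ := ⨅ n : Fin (d - 1), h (n.val + 1)

/-- The single number measuring the noise stability of the network,
`β c d^{3/2} max_{x ∈ S} ‖f_θ(x)‖ / (h_min^{1/2} min_{2 ≤ i ≤ d} μ_i μ_{i→})`. -/
def noiseLevel (β : ℝ) (θ : Params d h) (S : Finset (Vec (h 0) × Vec (h d))) : ℝ :=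
  β * activationContraction θ S * (d : ℝ) ^ (3 / 2 : ℝ) * maxOutput θ S /
    (Real.sqrt (minWidth d h) * minCushion θ S)

/-! ### The dropout procedure -/

/-- The outcomes of the dropout procedure: `ω n b = true` means that column `b` of the matrix
`A_{n+1}` is dropped. -/
abbrev Mask (d : ℕ) (h : ℕ → ℕ) : Type := (n : Fin d) → Fin (h n.val) → Bool

/-- The law of the dropout procedure with dropout probability `p`: all columns are dropped
independently, each with probability `p`. -/
def dropoutLaw (d : ℕ) (h : ℕ → ℕ) (p : unitInterval) : Measure (Mask d h) :=
  Measure.pi fun _ => Measure.pi fun _ => ProbabilityTheory.bernoulliMeasure true false p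

/-- The network `θ^i = (A_1, Â_2, …, Â_i, A_{i+1}, …, A_d)`, where `Â_m` is `A_m` with the dropped
columns multiplied by `0` and the others by `1 / (1 - p)`. The first matrix is never changed. -/
def dropout (p : unitInterval) (θ : Params d h) (ω : Mask d h) (i : ℕ) : Params d h :=
  fun n => Matrix.of fun a b =>
    if 1 ≤ n.val ∧ n.val + 1 ≤ i then
      (if ω n b = true then 0 else 1 / (1 - (p : ℝ))) * θ n a b
    else θ n a b

/-- The vector `x̂^i_m(t)` before activation at layer `i`, on input `x`, of the network with
parameters `t θ + (1 - t) θ^m`. -/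
def noisyPreact (p : unitInterval) (θ : Params d h) (ω : Mask d h) (m : ℕ) (t : ℝ)
    (x : Vec (h 0)) (i : ℕ) : Vec (h i) :=
  preact (t • θ + (1 - t) • dropout p θ ω m) x i

/-- The outcomes of the dropout procedure for which the two inequalities of interlayer smoothness
hold with the number `ρ`, for all layers `2 ≤ i ≤ j ≤ d` (with `j = i + k`), all samples and all
`0 ≤ t ≤ 1`. -/
def smoothEvent (p : unitInterval) (θ : Params d h) (S : Finset (Vec (h 0) × Vec (h d)))
    (ρ : ℝ) : Set (Mask d h) :=
  {ω | ∀ i k : ℕ, 2 ≤ i → i + k ≤ d → ∀ z ∈ S, ∀ t ∈ Icc (0 : ℝ) 1,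
    ‖layers θ i k (noisyPreact p θ ω i t z.1 i)
        - jacobian θ z.1 i k (noisyPreact p θ ω i t z.1 i)‖
      ≤ ‖noisyPreact p θ ω i t z.1 i - preact θ z.1 i‖ * ‖preact θ z.1 (i + k)‖
          / (ρ * ‖preact θ z.1 i‖) ∧
    ‖layers θ i k (noisyPreact p θ ω (i - 1) t z.1 i)
        - jacobian θ z.1 i k (noisyPreact p θ ω (i - 1) t z.1 i)‖
      ≤ ‖noisyPreact p θ ω (i - 1) t z.1 i - preact θ z.1 i‖ * ‖preact θ z.1 (i + k)‖
          / (ρ * ‖preact θ z.1 i‖)}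

/-- The outcomes of the dropout procedure for which
`‖φ(x̂^i_i(t))‖_∞ ≤ (K / √h_i) ‖φ(x̂^i_i(t))‖` for all hidden layers `1 ≤ i ≤ d - 1`, all samples
and all `0 ≤ t ≤ 1`. -/
def spreadEvent (p : unitInterval) (θ : Params d h) (S : Finset (Vec (h 0) × Vec (h d)))
    (K : ℝ) : Set (Mask d h) :=
  {ω | ∀ i : ℕ, 1 ≤ i → i < d → ∀ z ∈ S, ∀ t ∈ Icc (0 : ℝ) 1, ∀ a : Fin (h i),
    |relu (noisyPreact p θ ω i t z.1 i) a|
      ≤ K / Real.sqrt (h i) * ‖relu (noisyPreact p θ ω i t z.1 i)‖}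

/-- `ε`-noise stability of the network `θ` on the sample `S`, for a loss with Lipschitz constant
`β`, for dropout probability `p`, and with `K` the constant in the bound on the sup norms of the
activations. Positivity of the cushions says that the quantities are meaningful: it forces all the
denominators in their definitions to be nonzero and the Jacobians to exist.
The interlayer smoothness is at least `3 d`. -/
structure IsNoiseStable (p : unitInterval) (K β : ℝ) (S : Finset (Vec (h 0) × Vec (h d)))
    (θ : Params d h) (ε : ℝ) : Prop where
  cushion_pos : 0 < minCushion θ S
  smooth : ∃ ρ : ℝ, 3 * (d : ℝ) ≤ ρ ∧
    1 / 2 ≤ dropoutLaw d h p (smoothEvent p θ S ρ ∩ spreadEvent p θ S K)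
  level_le : noiseLevel β θ S ≤ ε

end Network

/-- The logarithmic factor: the logarithm of (two plus) the sample size, the number of layers and
the sum of the widths `h 1, …, h d`. -/
def logFactor (d : ℕ) (h : ℕ → ℕ) (N : ℕ) : ℝ :=
  Real.log (2 + N + d + ∑ i ∈ Finset.Icc 1 d, h i)

/-- `π : [0,1] → V` is a continuous path from `a` to `b` consisting of `n` line segments
(parametrized so that the `m`-th segment is run through on `[m/n, (m+1)/n]`). -/
structure IsPolygonalPath {V : Type*} [AddCommGroup V] [Module ℝ V] [TopologicalSpace V]
    (n : ℕ) (π : ℝ → V) (a b : V) : Prop where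
  continuousOn : ContinuousOn π (Icc 0 1)
  source : π 0 = a
  target : π 1 = b
  segment : ∀ m : ℕ, m < n → ∀ s ∈ Icc (0 : ℝ) 1,
    π ((m + s) / n) = (1 - s) • π ((m : ℝ) / n) + s • π (((m : ℝ) + 1) / n)

end NoiseStability

end

namespace NoiseStability

variable {d : ℕ} {h : ℕ → ℕ}

/-! ### Evaluation of networks -/

/-! A noise stable network is joined by one segment of small loss to a network in which at most half
of the units of every hidden layer are alive, and two such half-empty networks can be joined without
exceeding the larger of their losses. This takes 1 + 5 + 1 segments; the remaining three are
constant.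

Joining half-empty networks `A` and `B` (`exists_path_of_isSupportedOn`): the rows of dead units may
be overwritten freely, since no alive unit reads from them. The alive units of `A` and `B` fit
together into every hidden layer, so a copy of `B` can be written on dead units of `A`. Then the
last layer is switched from `A` to the copy; the output is affine in this layer and the loss is
convex, so nothing is lost. Finally the copy is moved to the place of `B`, by way of duplicates of
its units.

Reaching a half-empty network (`IsNoiseStable.exists_half`): dropout with probability 3/4 keeps a
quarter of the units on average, hence rarely more than half. Dropping columns is centred noise: a
unit of the next layer changes by a sum of independent terms, of size about its row norm times the
sup norm of the activations, which the spread condition bounds by their ℓ² norm over √h. Summing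
over the units gives a Frobenius norm, which the layer cushion turns into a relative error. The
interlayer cushion keeps the Jacobians from amplifying this error, and interlayer smoothness with ρ
≥ 3d controls the nonlinear remainder. Telescoping over the dropped layers gives the relative error
4dγ with γ = `relNoise` (`norm_noisyPreact_sub_le`).

One mask has to serve the whole segment 0 ≤ t ≤ 1. The activations are piecewise polynomial in t,
so, with N the number inside the logarithm, N^{O(d)} values of t represent them all
(`exists_net_layerInput`). The union bound over these values forces deviations of order √(d log N);
this √d and the d of the telescoping sum make up d^{3/2}. The net of a layer depends only on the
masks of earlier layers, so it is fixed while the mask of the layer itself is drawn. If 4dγ > 1, the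
claim is trivial: the last layer is deleted. -/

theorem apply_coord {m n : ℕ} (A : Matrix (Fin m) (Fin n) ℝ) (v : Vec n) (a : Fin m) :
    apply A v a = ∑ b, A a b * v b := by
  simp [apply, Matrix.mulVec, dotProduct]

@[simp] theorem relu_coord {n : ℕ} (v : Vec n) (a : Fin n) : relu v a = max (v a) 0 := rfl

theorem weight_of_lt (θ : Params d h) {n : ℕ} (hn : n < d) : weight θ n = θ ⟨n, hn⟩ :=
  dif_pos hn

/-- The input of layer `n + 1`: the network input for `n = 0`, the activations of layer `n`
otherwise. -/
noncomputable def layerInput (θ : Params d h) (x : Vec (h 0)) : (n : ℕ) → Vec (h n)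
  | 0 => x
  | n + 1 => relu (preact θ x (n + 1))

theorem preact_succ (θ : Params d h) (x : Vec (h 0)) (n : ℕ) :
    preact θ x (n + 1) = apply (weight θ n) (layerInput θ x n) := by
  cases n <;> rfl

theorem layerInput_of_pos (θ : Params d h) (x : Vec (h 0)) {n : ℕ} (hn : 1 ≤ n) :
    layerInput θ x n = relu (preact θ x n) := by
  obtain ⟨n, rfl⟩ := Nat.exists_eq_add_of_le' hn
  rfl

theorem preact_congr {θ θ' : Params d h} (x : Vec (h 0)) {n : ℕ}
    (H : ∀ m < n, weight θ m = weight θ' m) : preact θ x n = preact θ' x n := by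
  induction n with
  | zero => rfl
  | succ n ih =>
    have ih := ih fun m hm => H m (hm.trans n.lt_succ_self)
    rw [preact_succ, preact_succ, H n n.lt_succ_self]
    cases n with
    | zero => rfl
    | succ n => rw [layerInput_of_pos _ _ (by omega), layerInput_of_pos _ _ (by omega), ih]

/-- If, on the units in `G`, every layer of `θ` computes what the layer of `θ'` computes on the
images under `r` of these units, then so does the whole network. -/
theorem preact_eq_of_simulates {θ θ' : Params d h} (G : ∀ n, Set (Fin (h n)))
    (r : ∀ n, Fin (h n) → Fin (h n)) (hr : ∀ a, r 0 a = a)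
    (H : ∀ n, n < d → ∀ a ∈ G (n + 1), ∀ v v' : Vec (h n), (∀ b ∈ G n, v b = v' (r n b)) →
      apply (weight θ n) v a = apply (weight θ' n) v' (r (n + 1) a))
    (x : Vec (h 0)) {n : ℕ} (hn : n ≤ d) {a : Fin (h n)} (ha : a ∈ G n) :
    preact θ x n a = preact θ' x n (r n a) := by
  induction n with
  | zero => rw [hr]; rfl
  | succ n ih =>
    rw [preact_succ, preact_succ]
    refine H n hn a ha _ _ fun b hb => ?_
    cases n with
    | zero => rw [hr]; rfl
    | succ n =>
      rw [layerInput_of_pos _ _ (by omega), layerInput_of_pos _ _ (by omega), relu_coord,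
        relu_coord, ih (by omega) hb]

/-- The alive units `U` of `θ` do not read from the dead ones. -/
def IsSupportedOn (θ : Params d h) (U : ∀ n, Set (Fin (h n))) : Prop :=
  ∀ n, n < d → ∀ a ∈ U (n + 1), ∀ b ∉ U n, weight θ n a b = 0

/-- By induction the alive units carry the same values in both networks, whatever stands in the dead
rows of `θ`. This is what makes dead rows free to overwrite. -/
theorem output_eq_of_eqOn_rows {θ θ' : Params d h} {U : ∀ n, Set (Fin (h n))}
    (hU : ∀ a, a ∈ U d) (hs : IsSupportedOn θ' U)
    (H : ∀ n, n < d → ∀ a ∈ U (n + 1), ∀ b, weight θ n a b = weight θ' n a b) (x : Vec (h 0)) :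
    output θ x = output θ' x := by
  ext a
  refine preact_eq_of_simulates U (fun _ => id) (fun _ => rfl) ?_ x le_rfl (hU a)
  intro n hn a ha v v' hv
  rw [apply_coord, apply_coord]
  refine Finset.sum_congr rfl fun b _ => ?_
  rw [H n hn a ha]
  by_cases hb : b ∈ U n
  · rw [hv b hb]; rfl
  · simp [hs n hn a ha b hb]

theorem weight_convexComb (θ θ' : Params d h) (s t : ℝ) (n : ℕ) :
    weight (s • θ + t • θ') n = s • weight θ n + t • weight θ' n := by
  unfold weight
  split_ifs with hn <;> simp

theorem apply_convexComb {m n : ℕ} (A B : Matrix (Fin m) (Fin n) ℝ) (s t : ℝ) (v : Vec n) :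
    apply (s • A + t • B) v = s • apply A v + t • apply B v := by
  ext a
  simp only [apply_coord, PiLp.add_apply, PiLp.smul_apply, Matrix.add_apply, Matrix.smul_apply,
    smul_eq_mul, Finset.mul_sum, ← Finset.sum_add_distrib]
  exact Finset.sum_congr rfl fun b _ => by ring

/-- The output is affine in the last layer. -/
theorem output_convexComb {θ θ' : Params d h} (hd : 1 ≤ d)
    (H : ∀ n, n + 1 < d → weight θ n = weight θ' n) (x : Vec (h 0)) {s t : ℝ} (hst : s + t = 1) :
    output (s • θ + t • θ') x = s • output θ x + t • output θ' x := by
  obtain ⟨d, rfl⟩ := Nat.exists_eq_add_of_le' hd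
  have key : ∀ ψ : Params (d + 1) h, (∀ n, n + 1 < d + 1 → weight ψ n = weight θ n) →
      output ψ x = apply (weight ψ d) (layerInput θ x d) := by
    intro ψ hψ
    unfold output
    rw [preact_succ]
    have := preact_congr (θ := ψ) (θ' := θ) x (n := d) fun m hm => hψ m (by omega)
    cases d with
    | zero => rfl
    | succ n => rw [layerInput_of_pos _ _ (by omega), layerInput_of_pos _ _ (by omega), this]
  rw [key _ fun n hn => ?_, key θ fun _ _ => rfl, key θ' fun n hn => (H n hn).symm,
    weight_convexComb, apply_convexComb]
  rw [weight_convexComb, ← H n hn, ← add_smul, hst, one_smul]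

/-! ### The loss -/

section Loss

variable {l : Vec (h d) → Vec (h d) → ℝ} {S : Finset (Vec (h 0) × Vec (h d))}

theorem loss_congr {θ θ' : Params d h} (H : ∀ z ∈ S, output θ z.1 = output θ' z.1) :
    loss l S θ = loss l S θ' := by
  unfold loss
  congr 1
  exact Finset.sum_congr rfl fun z hz => by rw [H z hz]

theorem loss_le_max_of_convexComb (hl : ∀ y, ConvexOn ℝ Set.univ (l y)) {θ θ₁ θ₂ : Params d h}
    {s t : ℝ} (hs : 0 ≤ s) (ht : 0 ≤ t) (hst : s + t = 1)
    (H : ∀ z ∈ S, output θ z.1 = s • output θ₁ z.1 + t • output θ₂ z.1) :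
    loss l S θ ≤ max (loss l S θ₁) (loss l S θ₂) := by
  have : loss l S θ ≤ s * loss l S θ₁ + t * loss l S θ₂ := by
    have e : s * loss l S θ₁ + t * loss l S θ₂ = (S.card : ℝ)⁻¹ *
        ∑ z ∈ S, (s * l z.2 (output θ₁ z.1) + t * l z.2 (output θ₂ z.1)) := by
      unfold loss
      rw [Finset.sum_add_distrib, ← Finset.mul_sum, ← Finset.mul_sum]
      ring
    rw [e]
    unfold loss
    refine mul_le_mul_of_nonneg_left (Finset.sum_le_sum fun z hz => ?_) (by positivity)
    rw [H z hz]
    exact (hl z.2).2 (mem_univ _) (mem_univ _) hs ht hst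
  refine this.trans ?_
  calc s * loss l S θ₁ + t * loss l S θ₂
      ≤ s * max (loss l S θ₁) (loss l S θ₂) + t * max (loss l S θ₁) (loss l S θ₂) :=
        add_le_add (mul_le_mul_of_nonneg_left (le_max_left _ _) hs)
          (mul_le_mul_of_nonneg_left (le_max_right _ _) ht)
    _ = max (loss l S θ₁) (loss l S θ₂) := by rw [← add_mul, hst, one_mul]

theorem loss_le_add_of_norm_sub_le (hS : S.Nonempty) {β D : ℝ} (hβ : 0 ≤ β)
    (hl : ∀ y u v, |l y u - l y v| ≤ β * ‖u - v‖) {θ θ' : Params d h}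
    (H : ∀ z ∈ S, ‖output θ' z.1 - output θ z.1‖ ≤ D) :
    loss l S θ' ≤ loss l S θ + β * D := by
  have hc : (0 : ℝ) < S.card := by exact_mod_cast hS.card_pos
  have e : loss l S θ + β * D = (S.card : ℝ)⁻¹ * ∑ z ∈ S, (l z.2 (output θ z.1) + β * D) := by
    unfold loss
    rw [Finset.sum_add_distrib, Finset.sum_const, nsmul_eq_mul]
    field_simp
  rw [e]
  unfold loss
  refine mul_le_mul_of_nonneg_left (Finset.sum_le_sum fun z hz => ?_) (by positivity)
  have h1 := (le_abs_self _).trans (hl z.2 (output θ' z.1) (output θ z.1))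
  have h2 := mul_le_mul_of_nonneg_left (H z hz) hβ
  linarith

end Loss

/-! ### Polygonal paths -/

theorem exists_polygonalPath {V : Type*} [AddCommGroup V] [Module ℝ V] [TopologicalSpace V]
    [ContinuousAdd V] [ContinuousSMul ℝ V] {n : ℕ} (hn : 0 < n) (P : ℕ → V) :
    ∃ π : ℝ → V, IsPolygonalPath n π (P 0) (P n) ∧
      ∀ t ∈ Icc (0 : ℝ) 1, ∃ m < n, ∃ s ∈ Icc (0 : ℝ) 1,
        π t = (1 - s) • P m + s • P (m + 1) := by
  have hn' : (0 : ℝ) < n := by exact_mod_cast hn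
  -- The clamp of `n * t - m` to `[0, 1]` runs through the edge `m` during its time interval; it is
  -- `0` before and `1` after.
  let π : ℝ → V := fun t =>
    P 0 + ∑ m ∈ Finset.range n, max 0 (min 1 (n * t - m)) • (P (m + 1) - P m)
  have main : ∀ m < n, ∀ s ∈ Icc (0 : ℝ) 1,
      π ((m + s) / n) = (1 - s) • P m + s • P (m + 1) := by
    intro m hm s hs
    have hsum : ∑ k ∈ Finset.range n, max 0 (min 1 (n * ((m + s) / n) - k)) • (P (k + 1) - P k)
        = ∑ k ∈ Finset.range (m + 1), max 0 (min 1 (m + s - k)) • (P (k + 1) - P k) := by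
      rw [mul_div_cancel₀ _ hn'.ne']
      symm
      refine Finset.sum_subset (Finset.range_mono hm) fun k _ hk => ?_
      have hk : (m : ℝ) + 1 ≤ k := by
        have : m + 1 ≤ k := by simpa using hk
        exact_mod_cast this
      rw [max_eq_left, zero_smul]
      exact (min_le_right _ _).trans (by linarith [hs.2])
    have hpre : ∑ k ∈ Finset.range m, max 0 (min 1 ((m : ℝ) + s - k)) • (P (k + 1) - P k)
        = P m - P 0 := by
      rw [← Finset.sum_range_sub]
      refine Finset.sum_congr rfl fun k hk => ?_
      have hk : (k : ℝ) + 1 ≤ m := by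
        have : k + 1 ≤ m := by simpa using hk
        exact_mod_cast this
      rw [min_eq_left (by linarith [hs.1]), max_eq_right zero_le_one, one_smul]
    show P 0 + _ = _
    rw [hsum, Finset.sum_range_succ, hpre, add_sub_cancel_left, min_eq_right hs.2,
      max_eq_right hs.1]
    module
  have vertex : ∀ m ≤ n, π (m / n) = P m := by
    intro m hm
    rcases hm.lt_or_eq with hm | rfl
    · simpa using main m hm 0 ⟨le_rfl, zero_le_one⟩
    · obtain ⟨k, rfl⟩ : ∃ k, m = k + 1 := ⟨m - 1, by omega⟩
      have := main k (by omega) 1 ⟨zero_le_one, le_rfl⟩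
      push_cast at this ⊢
      simpa using this
  refine ⟨π, ⟨?_, ?_, ?_, ?_⟩, ?_⟩
  · refine Continuous.continuousOn ?_
    show Continuous fun t => P 0 + _
    fun_prop
  · simpa using vertex 0 (Nat.zero_le _)
  · simpa [hn'.ne'] using vertex n le_rfl
  · intro m hm s hs
    have h2 := vertex (m + 1) hm
    push_cast at h2
    rw [main m hm s hs, vertex m hm.le, h2]
  · intro t ht
    rcases ht.2.lt_or_eq with h1 | rfl
    · refine ⟨⌊n * t⌋₊, ?_, n * t - ⌊n * t⌋₊, ⟨?_, ?_⟩, ?_⟩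
      · rw [Nat.floor_lt (by have := ht.1; positivity)]
        nlinarith
      · have := Nat.floor_le (a := n * t) (by have := ht.1; positivity)
        linarith
      · have := Nat.lt_floor_add_one (n * t)
        linarith
      · rw [← main]
        · congr 1; field_simp; ring
        · rw [Nat.floor_lt (by have := ht.1; positivity)]
          nlinarith
        · constructor
          · have := Nat.floor_le (a := n * t) (by have := ht.1; positivity)
            linarith
          · have := Nat.lt_floor_add_one (n * t)
            linarith
    · obtain ⟨k, rfl⟩ : ∃ k, n = k + 1 := ⟨n - 1, by omega⟩
      refine ⟨k, by omega, 1, ⟨zero_le_one, le_rfl⟩, ?_⟩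
      rw [← main k (by omega) 1 ⟨zero_le_one, le_rfl⟩]
      congr 1
      push_cast
      rw [div_self]
      positivity

/-! ### Connecting two networks with few alive units -/

/-- If two sets occupy together at most as many elements as there are, the second one can be moved
off the first one without moving any element onto another one of its elements. -/
theorem exists_perm_disjoint {α : Type*} [Fintype α] [DecidableEq α] (A B : Finset α)
    (hAB : A.card + B.card ≤ Fintype.card α) :
    ∃ σ : Equiv.Perm α, ∀ b ∈ B, σ b ∉ A ∧ (σ b ∈ B → σ b = b) := by
  -- The elements of `A ∩ B` are sent to a set `Y` of free places, while those of `B \ A` stay.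
  have h0 : (A ∩ B).card ≤ ((A ∪ B)ᶜ).card := by
    have := Finset.card_union_add_card_inter A B
    rw [Finset.card_compl]
    omega
  obtain ⟨Y, hY, hYc⟩ := Finset.exists_subset_card_eq h0
  have hYn : ∀ y ∈ Y, y ∉ A ∧ y ∉ B := fun y hy => by
    have := hY hy
    simpa using this
  have hdisj : Disjoint (B \ A) Y := Finset.disjoint_right.2 fun y hy hy' =>
    (hYn y hy).2 (Finset.mem_sdiff.1 hy').1
  have hcard : Fintype.card B = ((B \ A) ∪ Y).card := by
    rw [Finset.card_union_of_disjoint hdisj, hYc, Fintype.card_coe, Finset.inter_comm,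
      Finset.card_sdiff_add_card_inter]
  obtain ⟨g, hg⟩ := Finset.exists_equiv_extend_of_card_eq (α := B) hcard
    (s := Finset.univ.filter fun b : B => (b : α) ∉ A) (f := fun b => (b : α))
    (by
      intro x hx
      simp only [Finset.mem_image, Finset.mem_filter, Finset.mem_univ, true_and] at hx
      obtain ⟨b, hb, rfl⟩ := hx
      exact Finset.mem_union_left _ (Finset.mem_sdiff.2 ⟨b.2, hb⟩))
    (fun _ _ _ _ e => Subtype.ext e)
  let σ : Equiv.Perm α := Equiv.extendSubtype (p := fun x => x ∈ B) (q := fun x => x ∈ (B \ A) ∪ Y) g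
  have hσ : ∀ b (hb : b ∈ B), σ b = g ⟨b, hb⟩ := fun b hb =>
    Equiv.extendSubtype_apply_of_mem _ b hb
  have hfix : ∀ b ∈ B, b ∉ A → σ b = b := fun b hb hbA => by
    rw [hσ b hb, hg ⟨b, hb⟩ (by simpa using hbA)]
  have hmem : ∀ b ∈ B, σ b ∈ (B \ A) ∪ Y := fun b hb => by
    rw [hσ b hb]; exact (g ⟨b, hb⟩).2
  refine ⟨σ, fun b hb => ?_⟩
  rcases Finset.mem_union.1 (hmem b hb) with hm | hm
  · have hm := Finset.mem_sdiff.1 hm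
    exact ⟨hm.2, fun _ => σ.injective (hfix _ hm.1 hm.2)⟩
  · exact ⟨(hYn _ hm).1, fun hB => absurd hB (hYn _ hm).2⟩

/-- The first and the last layer of `U` are full, and `U` contains at most half of the units of each
hidden layer. -/
structure IsHalf (d : ℕ) (h : ℕ → ℕ) (U : ∀ n, Finset (Fin (h n))) : Prop where
  first : U 0 = Finset.univ
  last : U d = Finset.univ
  card_le : ∀ n, 1 ≤ n → n < d → 2 * (U n).card ≤ h n

/-- In a hidden layer `r` tells which unit of `B` a place is to copy. The old place `b` and the new
place `σ b` can both be copies of `b`, because `σ` moves no element of `UB` onto another one. -/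
theorem IsHalf.exists_relocation {UA UB : ∀ n, Finset (Fin (h n))} (hA : IsHalf d h UA)
    (hB : IsHalf d h UB) :
    ∃ (σ : ∀ n, Equiv.Perm (Fin (h n))) (r : ∀ n, Fin (h n) → Fin (h n)),
      (∀ a, r 0 a = a) ∧ (∀ a, r d a = a) ∧
      (∀ n, ∀ b ∈ UB n, r n b = b) ∧ (∀ n, ∀ b ∈ UB n, r n (σ n b) = b) ∧
      (∀ n, 1 ≤ n → n < d → ∀ b ∈ UB n, σ n b ∉ UA n) := by
  classical
  have : ∀ n, ∃ (σ : Equiv.Perm (Fin (h n))) (r : Fin (h n) → Fin (h n)),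
      (n = 0 ∨ n = d → ∀ a, r a = a) ∧ (∀ b ∈ UB n, r b = b) ∧
      (∀ b ∈ UB n, r (σ b) = b) ∧ (1 ≤ n → n < d → ∀ b ∈ UB n, σ b ∉ UA n) := by
    intro n
    by_cases hn : 1 ≤ n ∧ n < d
    · obtain ⟨σ, hσ⟩ := exists_perm_disjoint (UA n) (UB n) (by
        have := hA.card_le n hn.1 hn.2
        have := hB.card_le n hn.1 hn.2
        rw [Fintype.card_fin]
        omega)
      refine ⟨σ, fun a => if a ∈ UB n then a else σ.symm a, by omega, fun b hb => if_pos hb,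
        fun b hb => ?_, fun _ _ b hb => (hσ b hb).1⟩
      by_cases hm : σ b ∈ UB n
      · simp only [(hσ b hb).2 hm, if_pos hb]
      · simp [if_neg hm]
    · exact ⟨1, id, fun _ _ => rfl, fun _ _ => rfl, fun _ _ => rfl,
        fun h1 h2 => absurd ⟨h1, h2⟩ hn⟩
  choose σ r H1 H2 H3 H4 using this
  exact ⟨σ, r, H1 0 (Or.inl rfl), H1 d (Or.inr rfl), H2, H3, H4⟩

/-- The places `b` and `σ b` carry the same value, so incoming weight can be shifted gradually from
one to the other. -/
theorem sum_relocation {n : ℕ} {B : Finset (Fin n)} {σ : Equiv.Perm (Fin n)}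
    {r : Fin n → Fin n} (h1 : ∀ b ∈ B, r b = b) (h2 : ∀ b ∈ B, r (σ b) = b) {c : Fin n → ℝ}
    (hc : ∀ b ∉ B, c b = 0) {v v' : Fin n → ℝ} (hv : ∀ b, r b ∈ B → v b = v' (r b)) (s : ℝ) :
    ∑ b, ((1 - s) * c (σ.symm b) + s * c b) * v b = ∑ b, c b * v' b := by
  have e1 : ∑ b, c (σ.symm b) * v b = ∑ b, c b * v' b := by
    rw [← Equiv.sum_comp σ]
    refine Finset.sum_congr rfl fun b _ => ?_
    by_cases hb : b ∈ B
    · rw [Equiv.symm_apply_apply, hv _ (by rwa [h2 b hb]), h2 b hb]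
    · simp [hc b hb]
  have e2 : ∑ b, c b * v b = ∑ b, c b * v' b := by
    refine Finset.sum_congr rfl fun b _ => ?_
    by_cases hb : b ∈ B
    · rw [hv _ (by rwa [h1 b hb]), h1 b hb]
    · simp [hc b hb]
  calc ∑ b, ((1 - s) * c (σ.symm b) + s * c b) * v b
      = (1 - s) * ∑ b, c (σ.symm b) * v b + s * ∑ b, c b * v b := by
        rw [Finset.mul_sum, Finset.mul_sum, ← Finset.sum_add_distrib]
        exact Finset.sum_congr rfl fun b _ => by ring
    _ = ∑ b, c b * v' b := by rw [e1, e2]; ring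

/-- Two networks each of which uses at most half of the units of each hidden layer are connected by
five segments along which the loss does not exceed the larger one of theirs. -/
theorem exists_path_of_isSupportedOn (hd : 2 ≤ d) {l : Vec (h d) → Vec (h d) → ℝ}
    (hl : ∀ y, ConvexOn ℝ Set.univ (l y)) (S : Finset (Vec (h 0) × Vec (h d)))
    {A B : Params d h} {UA UB : ∀ n, Finset (Fin (h n))}
    (hA : IsHalf d h UA) (hB : IsHalf d h UB)
    (hsA : IsSupportedOn A fun n => ↑(UA n)) (hsB : IsSupportedOn B fun n => ↑(UB n)) :
    ∃ P : ℕ → Params d h, P 0 = A ∧ P 5 = B ∧ ∀ m < 5, ∀ s ∈ Icc (0 : ℝ) 1,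
      loss l S ((1 - s) • P m + s • P (m + 1)) ≤ max (loss l S A) (loss l S B) := by
  classical
  obtain ⟨σ, r, hr0, hrd, hr, hrσ, hσA⟩ := hA.exists_relocation hB
  -- `C` is the copy of `B` that reads from the new places `σ b`, and `E` has the same rows reading
  -- from the old places. `Q` is `A` with its dead rows taken from `C`, and `Q'` is `Q` with the
  -- last layer of `C`. The path runs through `A`, `Q`, `Q'`, `C`, `E`, `B`.
  let C : Params d h := fun n => Matrix.of fun a b => B n (r _ a) ((σ _).symm b)
  let E : Params d h := fun n => Matrix.of fun a b => B n (r _ a) b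
  let Q : Params d h := fun n => Matrix.of fun a b => if a ∈ UA _ then A n a b else C n a b
  let Q' : Params d h := fun n => Matrix.of fun a b => if n.val + 1 = d then C n a b else Q n a b
  have wC : ∀ n, n < d → ∀ a b, weight C n a b = weight B n (r _ a) ((σ _).symm b) :=
    fun n hn a b => by simp only [weight_of_lt _ hn]; rfl
  have wE : ∀ n, n < d → ∀ a b, weight E n a b = weight B n (r _ a) b :=
    fun n hn a b => by simp only [weight_of_lt _ hn]; rfl
  have wQ : ∀ n, n < d → ∀ a b, weight Q n a b =
      if a ∈ UA _ then weight A n a b else weight C n a b :=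
    fun n hn a b => by simp only [weight_of_lt _ hn]; rfl
  have wQ' : ∀ n, n < d → ∀ a b, weight Q' n a b =
      if n + 1 = d then weight C n a b else weight Q n a b :=
    fun n hn a b => by simp only [weight_of_lt _ hn]; rfl
  have wmix : ∀ (θ θ' : Params d h) (s : ℝ) n a b, weight ((1 - s) • θ + s • θ') n a b =
      (1 - s) * weight θ n a b + s * weight θ' n a b := fun θ θ' s n a b => by
    rw [weight_convexComb]; simp
  let V : ∀ n, Set (Fin (h n)) := fun n => {a | (σ n).symm a ∈ UB n}
  have hVr : ∀ n, ∀ a ∈ V n, r n a ∈ UB n := fun n a ha => by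
    have := hrσ n _ ha
    rw [Equiv.apply_symm_apply] at this
    rw [this]; exact ha
  have hVA : ∀ n, 1 ≤ n → n < d → ∀ a ∈ V n, a ∉ UA n := fun n h1 h2 a ha => by
    simpa using hσA n h1 h2 _ ha
  have hVd : ∀ a, a ∈ V d := fun a => by
    show _ ∈ UB d
    rw [hB.last]; exact Finset.mem_univ _
  have hsC : IsSupportedOn C V := fun n hn a ha b hb => by
    rw [wC n hn]
    exact hsB n hn _ (hVr _ a ha) _ hb
  have hsim : ∀ (s : ℝ) x, output ((1 - s) • C + s • E) x = output B x := by
    intro s x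
    ext a
    have := preact_eq_of_simulates (θ := (1 - s) • C + s • E) (θ' := B)
      (fun n => {a | r n a ∈ UB n}) r hr0 ?_ x le_rfl (a := a)
      (by show _ ∈ UB d; rw [hB.last]; exact Finset.mem_univ _)
    · rwa [hrd] at this
    · intro n hn a ha v v' hv
      rw [apply_coord, apply_coord,
        ← sum_relocation (hr n) (hrσ n) (c := fun b => weight B n (r _ a) b)
          (fun b hb => hsB n hn _ ha b hb) hv s]
      exact Finset.sum_congr rfl fun b _ => by rw [wmix, wC n hn, wE n hn]
  have oC : ∀ x, output C x = output B x := fun x => by simpa using hsim 0 x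
  have oQ' : ∀ x, output Q' x = output B x := fun x => by
    rw [← oC]
    refine output_eq_of_eqOn_rows hVd hsC (fun n hn a ha b => ?_) x
    rw [wQ' n hn, wQ n hn]
    split_ifs with h1 h2
    · rfl
    · exact absurd h2 (hVA _ (by omega) (by omega) a ha)
    · rfl
  have hAd : ∀ a, a ∈ (fun n => (↑(UA n) : Set (Fin (h n)))) d := fun a => by
    simp [hA.last]
  have hBd : ∀ a, a ∈ (fun n => (↑(UB n) : Set (Fin (h n)))) d := fun a => by
    simp [hB.last]
  have oAQ : ∀ (s : ℝ) x, output ((1 - s) • A + s • Q) x = output A x := fun s x => by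
    refine output_eq_of_eqOn_rows hAd hsA (fun n hn a ha b => ?_) x
    rw [wmix, wQ n hn, if_pos (by exact ha)]
    ring
  have oQ : ∀ x, output Q x = output A x := fun x => by simpa using oAQ 1 x
  let P : ℕ → Params d h := fun m => match m with
    | 0 => A | 1 => Q | 2 => Q' | 3 => C | 4 => E | _ => B
  refine ⟨P, rfl, rfl, fun m hm s hs => ?_⟩
  interval_cases m
  · exact (loss_congr fun z _ => oAQ s z.1).le.trans (le_max_left _ _)
  · refine loss_le_max_of_convexComb hl (sub_nonneg.2 hs.2) hs.1 (by ring) fun z _ => ?_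
    rw [← oQ, ← oQ']
    refine output_convexComb (by omega) (fun n hn => ?_) _ (by ring)
    ext a b
    show weight Q n a b = weight Q' n a b
    rw [wQ' n (by omega), if_neg hn.ne]
  · refine (loss_congr fun z _ => ?_).le.trans (le_max_right _ _)
    rw [← oC]
    refine output_eq_of_eqOn_rows hVd hsC (fun n hn a ha b => ?_) _
    show weight ((1 - s) • Q' + s • C) n a b = _
    rw [wmix, wQ' n hn, wQ n hn]
    split_ifs with h1 h2
    · ring
    · exact absurd h2 (hVA _ (by omega) (by omega) a ha)
    · ring
  · exact (loss_congr fun z _ => hsim s z.1).le.trans (le_max_right _ _)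
  · refine (loss_congr fun z _ => ?_).le.trans (le_max_right _ _)
    refine output_eq_of_eqOn_rows hBd hsB (fun n hn a ha b => ?_) _
    show weight ((1 - s) • E + s • B) n a b = _
    rw [wmix, wE n hn, hr _ a (by exact ha)]
    ring

/-! ### Piecewise polynomial functions -/

/-- On every interval without points of `R`, the function `f` is a polynomial of degree at most
`n`. -/
def IsPiecewisePoly (R : Finset ℝ) (n : ℕ) (f : ℝ → ℝ) : Prop :=
  ∀ s, ∃ P : Polynomial ℝ, P.natDegree ≤ n ∧
    ∀ t, Disjoint (uIcc s t) (R : Set ℝ) → f t = P.eval t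

theorem disjoint_uIcc_trans {R : Set ℝ} {r s t : ℝ} (h1 : Disjoint (uIcc r s) R)
    (h2 : Disjoint (uIcc s t) R) : Disjoint (uIcc r t) R :=
  (h1.union_left h2).mono_left uIcc_subset_uIcc_union_uIcc

/-- A finite set of points that meets every interval between consecutive points of `R`. -/
theorem exists_finset_gaps (R : Finset ℝ) (I : Set ℝ) :
    ∃ T : Finset ℝ, T.card ≤ 2 * R.card + 1 ∧ ↑T ⊆ I ∧
      ∀ t ∈ I, ∃ t' ∈ T, t' = t ∨ Disjoint (uIcc t' t) (R : Set ℝ) := by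
  classical
  -- `j` goes up by one on arriving at a point of `R` and by one on leaving it, so its at most `2 *
  -- R.card + 1` values tell apart the points of `R` and the gaps. One representative is chosen for
  -- each value attained on `I`.
  let j : ℝ → ℕ := fun t => (R.filter (· < t)).card + (R.filter (· ≤ t)).card
  have hj : ∀ s t, s < t → j s = j t → Disjoint (Icc s t) (R : Set ℝ) := by
    intro s t hst e
    have s1 : R.filter (· < s) ⊆ R.filter (· < t) :=
      Finset.monotone_filter_right _ fun x _ hx => lt_trans hx hst
    have s2 : R.filter (· ≤ s) ⊆ R.filter (· ≤ t) :=
      Finset.monotone_filter_right _ fun x _ hx => le_trans hx hst.le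
    have c1 := Finset.card_le_card s1
    have c2 := Finset.card_le_card s2
    have e1 := Finset.eq_of_subset_of_card_le s1 (by simp only [j] at e; omega)
    have e2 := Finset.eq_of_subset_of_card_le s2 (by simp only [j] at e; omega)
    refine Set.disjoint_left.2 fun x hx hxR => ?_
    rcases hx.2.lt_or_eq with hxt | rfl
    · have : x ∈ R.filter (· < s) := e1 ▸ Finset.mem_filter.2 ⟨hxR, hxt⟩
      exact absurd (Finset.mem_filter.1 this).2 (not_lt.2 hx.1)
    · have : x ∈ R.filter (· ≤ s) := e2 ▸ Finset.mem_filter.2 ⟨hxR, le_rfl⟩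
      exact absurd (Finset.mem_filter.1 this).2 (not_le.2 hst)
  have hj' : ∀ s t, j s = j t → s = t ∨ Disjoint (uIcc s t) (R : Set ℝ) := by
    intro s t e
    rcases lt_trichotomy s t with hst | hst | hst
    · right; rw [uIcc_of_le hst.le]; exact hj s t hst e
    · exact Or.inl hst
    · right; rw [uIcc_of_ge hst.le]; exact hj t s hst e.symm
  let K := (Finset.range (2 * R.card + 1)).filter fun k => ∃ t ∈ I, j t = k
  have hK : ∀ k ∈ K, ∃ t ∈ I, j t = k := fun k hk => (Finset.mem_filter.1 hk).2
  choose! g hgI hg using hK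
  refine ⟨K.image g, ?_, ?_, fun t ht => ?_⟩
  · refine Finset.card_image_le.trans ((Finset.card_filter_le _ _).trans ?_)
    rw [Finset.card_range]
  · intro x hx
    obtain ⟨k, hk, rfl⟩ := Finset.mem_image.1 hx
    exact hgI k hk
  · have hk : j t ∈ K := by
      refine Finset.mem_filter.2 ⟨Finset.mem_range.2 ?_, t, ht, rfl⟩
      have h1 := Finset.card_filter_le R (· < t)
      have h2 := Finset.card_filter_le R (· ≤ t)
      show _ + _ < _
      omega
    exact ⟨g (j t), Finset.mem_image_of_mem _ hk, hj' _ _ (hg _ hk)⟩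

/-- After adding breakpoints, a family of piecewise polynomial functions does not cross any of
finitely many levels between breakpoints. -/
theorem exists_refinement {ι : Type*} [Fintype ι] {R : Finset ℝ} {n : ℕ} {f : ι → ℝ → ℝ}
    (hf : ∀ i, IsPiecewisePoly R n (f i)) (Λ : Finset ℝ) :
    ∃ R' : Finset ℝ, R ⊆ R' ∧
      R'.card ≤ R.card + (2 * R.card + 1) * (Fintype.card ι * (Λ.card * n)) ∧
      ∀ s t, Disjoint (uIcc s t) (R' : Set ℝ) → ∀ i, ∀ c ∈ Λ, f i s ≤ c → f i t ≤ c := by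
  classical
  obtain ⟨T, hTc, -, hT⟩ := exists_finset_gaps R univ
  choose P hPn hP using hf
  -- The new breakpoints are the roots of `P i s - c` for one `s` in each piece. By the intermediate
  -- value theorem a level cannot be crossed without meeting one of them.
  let Z : Finset ℝ := T.biUnion fun s => Finset.univ.biUnion fun i => Λ.biUnion fun c =>
    (P i s - Polynomial.C c).roots.toFinset
  refine ⟨R ∪ Z, Finset.subset_union_left, ?_, ?_⟩
  · refine (Finset.card_union_le _ _).trans (Nat.add_le_add_left ?_ _)
    refine (Finset.card_biUnion_le_card_mul _ _ (Fintype.card ι * (Λ.card * n))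
      fun s _ => ?_).trans (Nat.mul_le_mul_right _ hTc)
    refine (Finset.card_biUnion_le_card_mul _ _ (Λ.card * n) fun i _ => ?_)
    refine (Finset.card_biUnion_le_card_mul _ _ n fun c _ => ?_)
    refine (Multiset.toFinset_card_le _).trans ((Polynomial.card_roots' _).trans ?_)
    rw [Polynomial.natDegree_sub_C]
    exact hPn i s
  · intro s t hst i c hc hs
    by_contra ht
    have hst1 : Disjoint (uIcc s t) (R : Set ℝ) :=
      hst.mono_right (Finset.coe_subset.2 Finset.subset_union_left)
    obtain ⟨s₀, hs₀, hss⟩ := hT s (mem_univ s)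
    have hd : Disjoint (uIcc s₀ s) (R : Set ℝ) := by
      rcases hss with rfl | hss
      · exact hst1.mono_left (by rw [uIcc_self]; simp)
      · exact hss
    have e1 := hP i s₀ s hd
    have e2 := hP i s₀ t (disjoint_uIcc_trans hd hst1)
    have hc' : c ∈ uIcc ((P i s₀).eval s) ((P i s₀).eval t) := by
      rw [← e1, ← e2]
      exact mem_uIcc.2 (Or.inl ⟨hs, (not_le.1 ht).le⟩)
    obtain ⟨u, hu, hu'⟩ := intermediate_value_uIcc (P i s₀).continuous.continuousOn hc'
    refine Set.disjoint_left.1 hst hu ?_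
    have hne : P i s₀ - Polynomial.C c ≠ 0 := fun h0 => by
      rw [sub_eq_zero] at h0
      rw [e2, h0, Polynomial.eval_C] at ht
      exact ht le_rfl
    refine Finset.mem_coe.2 (Finset.mem_union_right _ ?_)
    simp only [Z, Finset.mem_biUnion, Finset.mem_univ, true_and, Multiset.mem_toFinset]
    refine ⟨s₀, hs₀, i, c, hc, (Polynomial.mem_roots hne).2 ?_⟩
    simpa [Polynomial.IsRoot, sub_eq_zero] using hu'

theorem IsPiecewisePoly.const (R : Finset ℝ) (c : ℝ) : IsPiecewisePoly R 0 fun _ => c :=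
  fun _ => ⟨Polynomial.C c, by simp, fun _ _ => by simp⟩

theorem IsPiecewisePoly.sum_affine_mul {ι : Type*} [Fintype ι] {R : Finset ℝ} {n : ℕ}
    {f : ι → ℝ → ℝ} (hf : ∀ i, IsPiecewisePoly R n (f i)) (p q : ι → ℝ) :
    IsPiecewisePoly R (n + 1) fun t => ∑ i, (t * p i + (1 - t) * q i) * f i t := by
  intro s
  choose P hPn hP using fun i => hf i s
  refine ⟨∑ i, (Polynomial.C (p i - q i) * Polynomial.X + Polynomial.C (q i)) * P i, ?_, ?_⟩
  · refine Polynomial.natDegree_sum_le_of_forall_le _ _ fun i _ => ?_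
    refine Polynomial.natDegree_mul_le.trans ?_
    have := Polynomial.natDegree_linear_le (a := p i - q i) (b := q i)
    have := hPn i
    omega
  · intro t ht
    rw [Polynomial.eval_finsetSum]
    refine Finset.sum_congr rfl fun i _ => ?_
    rw [hP i t ht]
    simp only [Polynomial.eval_mul, Polynomial.eval_add, Polynomial.eval_C, Polynomial.eval_X]
    ring

theorem isPiecewisePoly_preact_succ (θ θ' : Params d h) (x : Vec (h 0)) {n : ℕ} {R : Finset ℝ}
    (hR : ∀ b, IsPiecewisePoly R n fun t => layerInput (t • θ + (1 - t) • θ') x n b)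
    (a : Fin (h (n + 1))) :
    IsPiecewisePoly R (n + 1) fun t => preact (t • θ + (1 - t) • θ') x (n + 1) a := by
  have := IsPiecewisePoly.sum_affine_mul hR (weight θ n a) (weight θ' n a)
  convert this using 2 with t
  rw [preact_succ, apply_coord, weight_convexComb]
  simp

/-- A layer multiplies activations by weights affine in `t`, which raises the degree by one. The
ReLU preserves piecewise polynomials once the zeros of the units become breakpoints. The bound is on
`2 * R.card + 1`, the number of points and gaps, because each layer multiplies exactly this quantity
by its factor. -/
theorem exists_isPiecewisePoly_layerInput (θ θ' : Params d h) (x : Vec (h 0)) (n : ℕ) :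
    ∃ R : Finset ℝ,
      2 * R.card + 1 ≤ ∏ m ∈ Finset.range n, (1 + 2 * (h (m + 1) * (m + 1))) ∧
      ∀ b, IsPiecewisePoly R n fun t => layerInput (t • θ + (1 - t) • θ') x n b := by
  induction n with
  | zero => exact ⟨∅, by simp, fun b => IsPiecewisePoly.const ∅ (x b)⟩
  | succ n ih =>
    obtain ⟨R, hRc, hR⟩ := ih
    have hpre := isPiecewisePoly_preact_succ θ θ' x hR
    obtain ⟨R', hRR', hcard, hlev⟩ := exists_refinement hpre {0}
    refine ⟨R', ?_, fun b s => ?_⟩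
    · rw [Finset.prod_range_succ]
      simp only [Fintype.card_fin, Finset.card_singleton, one_mul] at hcard
      refine le_trans ?_ (Nat.mul_le_mul_right _ hRc)
      nlinarith
    · obtain ⟨P, hPn, hP⟩ := hpre b s
      by_cases hs : preact (s • θ + (1 - s) • θ') x (n + 1) b ≤ 0
      · refine ⟨0, by simp, fun t ht => ?_⟩
        have := hlev s t ht b 0 (by simp) hs
        show layerInput _ x (n + 1) b = _
        rw [layerInput_of_pos _ _ n.succ_pos, relu_coord, max_eq_right this]
        simp
      · refine ⟨P, hPn, fun t ht => ?_⟩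
        have : ¬ preact (t • θ + (1 - t) • θ') x (n + 1) b ≤ 0 := fun h0 =>
          hs (hlev t s (by rwa [uIcc_comm]) b 0 (by simp) h0)
        show layerInput _ x (n + 1) b = _
        rw [layerInput_of_pos _ _ n.succ_pos, relu_coord, max_eq_left (not_le.1 this).le]
        exact hP t (ht.mono_right (Finset.coe_subset.2 hRR'))

/-- The least multiple of `B / M` that is at least `max u 0` also bounds `max v 0`, as `u` and `v`
lie on the same side of it. -/
theorem abs_relu_sub_le {B : ℝ} {M : ℕ} (hB : 0 < B) (hM : 0 < M) {u v : ℝ}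
    (hu : max u 0 ≤ B)
    (hlev : ∀ k ∈ Finset.range (M + 1), (u ≤ k * B / M ↔ v ≤ k * B / M)) :
    max v 0 - max u 0 ≤ B / M := by
  have hM' : (0 : ℝ) < M := by exact_mod_cast hM
  set k := ⌈max u 0 * M / B⌉₊ with hk
  have h0 : 0 ≤ max u 0 * M / B := by positivity
  have hkM : k ≤ M := Nat.ceil_le.2 (by rw [div_le_iff₀ hB]; nlinarith)
  have hle : max u 0 ≤ k * B / M := by
    have := Nat.le_ceil (max u 0 * M / B)
    rw [div_le_iff₀ hB] at this
    rw [le_div_iff₀ hM']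
    exact this
  have hlt : (k : ℝ) * B / M < max u 0 + B / M := by
    have := Nat.ceil_lt_add_one h0
    rw [← hk, ← sub_lt_iff_lt_add, lt_div_iff₀ hB] at this
    rw [div_lt_iff₀ hM', add_mul, div_mul_cancel₀ _ hM'.ne']
    linarith
  have hv : v ≤ k * B / M :=
    (hlev k (Finset.mem_range.2 (by omega))).1 ((le_max_left _ _).trans hle)
  have : max v 0 ≤ k * B / M := max_le hv (by positivity)
  linarith

/-- A bounded curve of activations is within `B / h n` of one of its values at few points. -/
theorem exists_net_layerInput (θ θ' : Params d h) (x : Vec (h 0)) {n : ℕ} (hn : 1 ≤ n)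
    (hh : 0 < h n) {B : ℝ} (hB : 0 < B) :
    ∃ T : Finset ℝ,
      T.card ≤ (∏ m ∈ Finset.range (n - 1), (1 + 2 * (h (m + 1) * (m + 1)))) *
        (1 + 2 * (h n * ((h n + 1) * n))) ∧ ↑T ⊆ Icc (0 : ℝ) 1 ∧
      ((∀ t ∈ Icc (0 : ℝ) 1, ∀ b, layerInput (t • θ + (1 - t) • θ') x n b ≤ B) →
        ∀ t ∈ Icc (0 : ℝ) 1, ∃ t' ∈ T, ∀ b,
          |layerInput (t • θ + (1 - t) • θ') x n b - layerInput (t' • θ + (1 - t') • θ') x n b|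
            ≤ B / h n) := by
  classical
  obtain ⟨n, rfl⟩ := Nat.exists_eq_add_of_le' hn
  obtain ⟨R, hRc, hR⟩ := exists_isPiecewisePoly_layerInput θ θ' x n
  have hpre := isPiecewisePoly_preact_succ θ θ' x hR
  -- If no unit crosses a multiple of the step `B / h (n + 1)` in `[0, B]`, all units vary by at
  -- most one step, so one value of `t` per piece is enough.
  let Λ : Finset ℝ := (Finset.range (h (n + 1) + 1)).image fun k : ℕ => (k : ℝ) * B / h (n + 1)
  have hΛ : Λ.card ≤ h (n + 1) + 1 := Finset.card_image_le.trans (by simp)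
  obtain ⟨R', -, hcard, hlev⟩ := exists_refinement hpre Λ
  obtain ⟨T, hTc, hTI, hT⟩ := exists_finset_gaps R' (Icc 0 1)
  refine ⟨T, hTc.trans ?_, hTI, fun hbd t ht => ?_⟩
  · rw [Fintype.card_fin] at hcard
    have h2 : R'.card ≤ R.card +
        (2 * R.card + 1) * (h (n + 1) * ((h (n + 1) + 1) * (n + 1))) :=
      hcard.trans (by gcongr)
    rw [Nat.add_sub_cancel]
    refine le_trans ?_ (Nat.mul_le_mul_right _ hRc)
    nlinarith
  · obtain ⟨t', ht', hor⟩ := hT t ht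
    refine ⟨t', ht', fun b => ?_⟩
    rcases hor with rfl | hdis
    · rw [sub_self, abs_zero]; positivity
    · have hiff : ∀ k ∈ Finset.range (h (n + 1) + 1),
          (preact (t • θ + (1 - t) • θ') x (n + 1) b ≤ (k : ℕ) * B / h (n + 1) ↔
          preact (t' • θ + (1 - t') • θ') x (n + 1) b ≤ (k : ℕ) * B / h (n + 1)) := fun k hk =>
        ⟨hlev t t' (by rwa [uIcc_comm]) b _ (Finset.mem_image_of_mem _ hk),
          hlev t' t hdis b _ (Finset.mem_image_of_mem _ hk)⟩
      have b1 := hbd t ht b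
      have b2 := hbd t' (hTI ht') b
      rw [layerInput_of_pos _ _ (by omega), relu_coord] at b1 b2
      rw [layerInput_of_pos _ _ (by omega), layerInput_of_pos _ _ (by omega), relu_coord,
        relu_coord, abs_sub_le_iff]
      exact ⟨abs_relu_sub_le hB hh b2 fun k hk => (hiff k hk).symm,
        abs_relu_sub_le hB hh b1 hiff⟩

/-- Each lower layer costs `N ^ 2`; layer `n` costs `N ^ 3`, because its units have `h n + 1` levels
to avoid. -/
theorem net_card_le {n N : ℕ} (hn : 1 ≤ n) (hN : ∀ m, 1 ≤ m → m ≤ n → 2 + m + h m ≤ N) :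
    (∏ m ∈ Finset.range (n - 1), (1 + 2 * (h (m + 1) * (m + 1)))) *
      (1 + 2 * (h n * ((h n + 1) * n))) ≤ N ^ (2 * n + 1) := by
  have h1 : ∏ m ∈ Finset.range (n - 1), (1 + 2 * (h (m + 1) * (m + 1))) ≤ (N ^ 2) ^ (n - 1) := by
    refine (Finset.prod_le_pow_card _ _ (N ^ 2) fun m hm => ?_).trans (by simp)
    have hm := Finset.mem_range.1 hm
    refine le_trans ?_ (Nat.pow_le_pow_left (hN (m + 1) (by omega) (by omega)) 2)
    nlinarith
  have h2 : 1 + 2 * (h n * ((h n + 1) * n)) ≤ N ^ 3 := by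
    refine le_trans ?_ (Nat.pow_le_pow_left (hN n hn le_rfl) 3)
    nlinarith [mul_nonneg (Nat.zero_le (h n * h n)) (Nat.zero_le n),
      mul_nonneg (Nat.zero_le (h n)) (Nat.zero_le (n * n)), Nat.zero_le (n * n * n),
      Nat.zero_le (h n * h n * h n)]
  refine (Nat.mul_le_mul h1 h2).trans ?_
  rw [← pow_mul, ← pow_add]
  exact le_of_eq (by congr 1; omega)

/-! ### Concentration of the dropout noise -/

/-- The dropout probability `3 / 4`. -/
noncomputable abbrev dropProb : unitInterval := ⟨3 / 4, by norm_num, by norm_num⟩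

/-- The relative change of a column under dropout with probability `3 / 4`. -/
noncomputable def dropNoise (e : Bool) : ℝ := if e = true then -1 else 3

theorem abs_dropNoise_le (e : Bool) : |dropNoise e| ≤ 3 := by
  cases e <;> norm_num [dropNoise]

/-- The law of the mask of a single layer. -/
noncomputable abbrev maskLaw (n : ℕ) : Measure (Fin n → Bool) :=
  Measure.pi fun _ => ProbabilityTheory.bernoulliMeasure true false dropProb

open ProbabilityTheory in
-- Hoeffding's lemma: the mean is `3/4 * (-1) + 1/4 * 3 = 0`, and the values lie in an interval of
-- length `4`, whence the parameter `(4 / 2) ^ 2`.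
theorem hasSubgaussianMGF_dropNoise :
    HasSubgaussianMGF dropNoise 4 (bernoulliMeasure true false dropProb) := by
  have := hasSubgaussianMGF_of_mem_Icc_of_integral_eq_zero
    (μ := bernoulliMeasure true false dropProb) (X := dropNoise) (a := -1) (b := 3)
    (measurable_of_countable _).aemeasurable
    (ae_of_all _ fun e => by cases e <;> norm_num [dropNoise])
    (by rw [integral_bernoulliMeasure]; norm_num [dropNoise])
  have e : ((‖(3 : ℝ) - -1‖₊ / 2) ^ 2 : NNReal) = 4 := by
    ext
    norm_num
  rwa [e] at this

open ProbabilityTheory in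
theorem maskLaw_lt_sum_le {n : ℕ} (c : Fin n → ℝ) {σ lam : ℝ} (hσ : 0 ≤ σ) (hlam : 0 ≤ lam)
    (hc : ∑ b, c b ^ 2 ≤ σ ^ 2) :
    (maskLaw n).real {η | lam * σ < ∑ b, dropNoise (η b) * c b} ≤ Real.exp (-lam ^ 2 / 8) := by
  -- If all coefficients vanish, the exponent of the general bound is a division by zero and the
  -- bound is only `1`; but then the event is empty.
  rcases (Finset.sum_nonneg fun b (_ : b ∈ Finset.univ) => sq_nonneg (c b)).eq_or_lt with h0 | h0
  · have hc0 : ∀ b, c b = 0 := fun b => by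
      have := (Finset.sum_eq_zero_iff_of_nonneg fun b _ => sq_nonneg (c b)).1 h0.symm b
        (Finset.mem_univ b)
      simpa using this
    have : ¬ lam * σ < 0 := not_lt.2 (by positivity)
    simp [hc0, this, Real.exp_nonneg]
  have hind : iIndepFun (fun (b : Fin n) (η : Fin n → Bool) => c b * dropNoise (η b))
      (maskLaw n) :=
    iIndepFun_pi (X := fun b e => c b * dropNoise e)
      fun b => (measurable_of_countable _).aemeasurable
  have hsub : ∀ b ∈ (Finset.univ : Finset (Fin n)),
      HasSubgaussianMGF (fun η : Fin n → Bool => c b * dropNoise (η b))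
        (⟨c b ^ 2, sq_nonneg _⟩ * 4) (maskLaw n) := by
    intro b _
    refine HasSubgaussianMGF.const_mul ?_ (c b)
    refine HasSubgaussianMGF.of_map (X := dropNoise) (Y := fun η : Fin n → Bool => η b)
      (measurable_pi_apply b).aemeasurable ?_
    rw [(measurePreserving_eval (fun _ : Fin n => bernoulliMeasure true false dropProb) b).map_eq]
    exact hasSubgaussianMGF_dropNoise
  have key := HasSubgaussianMGF.measure_sum_ge_le_of_iIndepFun hind hsub
    (ε := lam * σ) (by positivity)
  refine (measureReal_mono (fun η hη => ?_)).trans (key.trans (Real.exp_le_exp.2 ?_))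
  · simp only [mem_ofPred_eq] at hη ⊢
    refine hη.le.trans (le_of_eq (Finset.sum_congr rfl fun b _ => mul_comm _ _))
  · have e : ((∑ b, (⟨c b ^ 2, sq_nonneg _⟩ * 4 : NNReal) : NNReal) : ℝ) = 4 * ∑ b, c b ^ 2 := by
      push_cast
      rw [Finset.mul_sum]
      exact Finset.sum_congr rfl fun b _ => mul_comm _ _
    rw [e]
    rw [div_le_div_iff₀ (by positivity) (by norm_num)]
    nlinarith [mul_le_mul_of_nonneg_left hc (sq_nonneg lam)]

theorem maskLaw_lt_abs_sum_le {n : ℕ} (c : Fin n → ℝ) {σ lam : ℝ} (hσ : 0 ≤ σ) (hlam : 0 ≤ lam)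
    (hc : ∑ b, c b ^ 2 ≤ σ ^ 2) :
    (maskLaw n).real {η | lam * σ < |∑ b, dropNoise (η b) * c b|} ≤
      2 * Real.exp (-lam ^ 2 / 8) := by
  have h1 := maskLaw_lt_sum_le c hσ hlam hc
  have h2 := maskLaw_lt_sum_le (fun b => -c b) hσ hlam (by simpa using hc)
  have hsub : {η : Fin n → Bool | lam * σ < |∑ b, dropNoise (η b) * c b|} ⊆
      {η | lam * σ < ∑ b, dropNoise (η b) * c b} ∪
      {η | lam * σ < ∑ b, dropNoise (η b) * -c b} := by
    intro η hη
    rcases lt_abs.1 (mem_ofPred_eq ▸ hη) with hη | hη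
    · exact Or.inl hη
    · right
      simpa using hη
  refine (measureReal_mono hsub).trans ((measureReal_union_le _ _).trans ?_)
  linarith

/-- Fubini in one coordinate. It will serve to draw the mask of one layer with all other masks
frozen. -/
theorem pi_real_le_of_forall_update {ι : Type*} [Fintype ι] [DecidableEq ι] {X : ι → Type*}
    [∀ i, MeasurableSpace (X i)] (μ : ∀ i, Measure (X i)) [∀ i, IsProbabilityMeasure (μ i)]
    {E : Set (∀ i, X i)} (hE : MeasurableSet E) (i : ι) {δ : ℝ} (hδ : 0 ≤ δ)
    (H : ∀ ω, (μ i).real {y | Function.update ω i y ∈ E} ≤ δ) :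
    (Measure.pi μ).real E ≤ δ := by
  have key : ∫⁻ ω, E.indicator 1 ω ∂Measure.pi μ ≤ ∫⁻ _, ENNReal.ofReal δ ∂Measure.pi μ := by
    refine lintegral_le_of_lmarginal_le {i} (measurable_one.indicator hE) measurable_const ?_
    intro ω
    rw [lmarginal_singleton, lmarginal_singleton]
    have hm : MeasurableSet {y | Function.update ω i y ∈ E} := (measurable_update ω) hE
    have e : (fun y => E.indicator (1 : (∀ i, X i) → ENNReal) (Function.update ω i y)) =
        {y | Function.update ω i y ∈ E}.indicator 1 := by
      ext y
      simp [Set.indicator]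
    show ∫⁻ y, E.indicator (1 : (∀ i, X i) → ENNReal) (Function.update ω i y) ∂μ i ≤
      ∫⁻ _, ENNReal.ofReal δ ∂μ i
    rw [e, lintegral_indicator_one hm, lintegral_const, measure_univ, mul_one]
    exact (ENNReal.le_ofReal_iff_toReal_le (measure_ne_top _ _) hδ).2 (H ω)
  rw [lintegral_indicator_one hE, lintegral_const, measure_univ, mul_one] at key
  exact ENNReal.toReal_le_of_le_ofReal hδ key

/-! ### The noise of a single layer -/

/-- The norm of a row of the matrix of layer `n + 1`. -/
noncomputable def rowNorm (θ : Params d h) (n : ℕ) (a : Fin (h (n + 1))) : ℝ :=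
  Real.sqrt (∑ b, weight θ n a b ^ 2)

theorem rowNorm_nonneg (θ : Params d h) (n : ℕ) (a : Fin (h (n + 1))) : 0 ≤ rowNorm θ n a :=
  Real.sqrt_nonneg _

theorem sq_rowNorm (θ : Params d h) (n : ℕ) (a : Fin (h (n + 1))) :
    rowNorm θ n a ^ 2 = ∑ b, weight θ n a b ^ 2 :=
  Real.sq_sqrt (Finset.sum_nonneg fun _ _ => sq_nonneg _)

theorem abs_weight_le_rowNorm (θ : Params d h) (n : ℕ) (a : Fin (h (n + 1))) (b : Fin (h n)) :
    |weight θ n a b| ≤ rowNorm θ n a := by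
  refine Real.abs_le_sqrt ?_
  exact Finset.single_le_sum (f := fun b => weight θ n a b ^ 2) (fun _ _ => sq_nonneg _)
    (Finset.mem_univ b)

/-- The activations of layer `n` on the segment between the network and its dropout version. -/
noncomputable def noisyAct (θ : Params d h) (ω : Mask d h) (n : ℕ) (t : ℝ) (x : Vec (h 0)) :
    Vec (h n) :=
  layerInput (t • θ + (1 - t) • dropout dropProb θ ω n) x n

/-- The change of the unit `a` of layer `n + 1` under full dropout of that layer. -/
noncomputable def layerNoise (θ : Params d h) (ω : Mask d h) {n : ℕ} (hn : n < d) (t : ℝ)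
    (x : Vec (h 0)) (a : Fin (h (n + 1))) : ℝ :=
  ∑ b, dropNoise (ω ⟨n, hn⟩ b) * (weight θ n a b * noisyAct θ ω n t x b)

theorem noisyAct_nonneg (θ : Params d h) (ω : Mask d h) {n : ℕ} (hn : 1 ≤ n) (t : ℝ)
    (x : Vec (h 0)) (b : Fin (h n)) : 0 ≤ noisyAct θ ω n t x b := by
  rw [noisyAct, layerInput_of_pos _ _ hn]
  exact le_max_right _ _

theorem dropout_update (p : unitInterval) (θ : Params d h) (ω : Mask d h) (n : Fin d)
    (η : Fin (h n) → Bool) :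
    dropout p θ (Function.update ω n η) n = dropout p θ ω n := by
  funext m
  ext a b
  simp only [dropout, Matrix.of_apply]
  by_cases hm : 1 ≤ m.val ∧ m.val + 1 ≤ n.val
  · have : m ≠ n := fun e => by rw [e] at hm; omega
    simp only [if_pos hm, Function.update_of_ne this]
  · simp only [if_neg hm]

/-- The outcomes for which too many units of layer `n` are alive, or the change of some unit of
layer `n + 1` is large although the activations of layer `n` are bounded. -/
def badEvent (θ : Params d h) (S : Finset (Vec (h 0) × Vec (h d))) {n : ℕ} (hn : n < d)
    (B : Vec (h 0) → ℝ) (lam : ℝ) : Set (Mask d h) :=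
  {ω | (h n : ℝ) < ∑ b, dropNoise (ω ⟨n, hn⟩ b) ∨
    ∃ z ∈ S, (∀ t ∈ Icc (0 : ℝ) 1, ∀ b, noisyAct θ ω n t z.1 b ≤ B z.1) ∧
      ∃ t ∈ Icc (0 : ℝ) 1, ∃ a,
        (lam + 3) * (rowNorm θ n a * B z.1) < |layerNoise θ ω hn t z.1 a|}

/-- Each of the `h n` terms changes by at most `3 * (rowNorm θ n a * (B / h n))`. This price of
passing to the net is the `3` in `lam + 3`. -/
theorem abs_layerNoise_sub_le (θ : Params d h) {n : ℕ} (hh : 0 < h n) (a : Fin (h (n + 1)))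
    (η : Fin (h n) → Bool) {v w : Fin (h n) → ℝ} {B : ℝ} (hvw : ∀ b, |v b - w b| ≤ B / h n) :
    |∑ b, dropNoise (η b) * (weight θ n a b * v b)| ≤
      |∑ b, dropNoise (η b) * (weight θ n a b * w b)| + 3 * (rowNorm θ n a * B) := by
  have hh' : (0 : ℝ) < h n := by exact_mod_cast hh
  have e : ∑ b, dropNoise (η b) * (weight θ n a b * v b) =
      ∑ b, dropNoise (η b) * (weight θ n a b * w b) +
        ∑ b, dropNoise (η b) * (weight θ n a b * (v b - w b)) := by
    rw [← Finset.sum_add_distrib]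
    exact Finset.sum_congr rfl fun b _ => by ring
  rw [e]
  refine (abs_add_le _ _).trans (add_le_add_right ?_ _)
  refine (Finset.abs_sum_le_sum_abs _ _).trans ?_
  have hb : ∀ b ∈ (Finset.univ : Finset (Fin (h n))),
      |dropNoise (η b) * (weight θ n a b * (v b - w b))| ≤ 3 * (rowNorm θ n a * (B / h n)) := by
    intro b _
    rw [abs_mul, abs_mul]
    exact mul_le_mul (abs_dropNoise_le _) (mul_le_mul (abs_weight_le_rowNorm _ _ _ _) (hvw b)
      (abs_nonneg _) (rowNorm_nonneg _ _ _)) (by positivity) (by norm_num)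
  refine (Finset.sum_le_card_nsmul _ _ _ hb).trans (le_of_eq ?_)
  rw [Finset.card_univ, Fintype.card_fin, nsmul_eq_mul]
  field_simp

/-- With all other masks frozen, the activations of layer `n` and their net are deterministic.
Hoeffding's bound and a union over samples, units and net points then apply; samples violating the
bound on the activations do not contribute. -/
theorem measure_badEvent_le (θ : Params d h) (S : Finset (Vec (h 0) × Vec (h d))) {n : ℕ}
    (hn1 : 1 ≤ n) (hn : n < d) (hh : 0 < h n) {B : Vec (h 0) → ℝ} (hB : ∀ z ∈ S, 0 < B z.1)
    {lam : ℝ} (hlam : 0 ≤ lam) {M : ℕ}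
    (hM : (∏ m ∈ Finset.range (n - 1), (1 + 2 * (h (m + 1) * (m + 1)))) *
        (1 + 2 * (h n * ((h n + 1) * n))) ≤ M) :
    (dropoutLaw d h dropProb).real (badEvent θ S hn B lam) ≤
      Real.exp (-(h n : ℝ) / 8) + S.card * h (n + 1) * M * (2 * Real.exp (-lam ^ 2 / 8)) := by
  classical
  refine pi_real_le_of_forall_update _ (Set.toFinite _).measurableSet ⟨n, hn⟩ (by positivity)
    fun ω => ?_
  -- The activations of layer `n` involve only matrices of index below `n`, hence not the mask `η`.
  have hact : ∀ η t x, noisyAct θ (Function.update ω ⟨n, hn⟩ η) n t x = noisyAct θ ω n t x := by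
    intro η t x
    unfold noisyAct
    rw [dropout_update dropProb θ ω ⟨n, hn⟩ η]
  have hnet : ∀ z ∈ S, ∃ T : Finset ℝ, T.card ≤ M ∧
      ((∀ t ∈ Icc (0 : ℝ) 1, ∀ b, noisyAct θ ω n t z.1 b ≤ B z.1) →
        ∀ t ∈ Icc (0 : ℝ) 1, ∃ t' ∈ T, t' ∈ Icc (0 : ℝ) 1 ∧ ∀ b,
          |noisyAct θ ω n t z.1 b - noisyAct θ ω n t' z.1 b| ≤ B z.1 / h n) := by
    intro z hz
    obtain ⟨T, hTc, hTI, hT⟩ := exists_net_layerInput θ (dropout dropProb θ ω n) z.1 hn1 hh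
      (hB z hz)
    refine ⟨T, hTc.trans hM, fun hbd t ht => ?_⟩
    obtain ⟨t', ht', hb⟩ := hT hbd t ht
    exact ⟨t', ht', hTI ht', hb⟩
  choose! T hTc hT using hnet
  let S' := S.filter fun z => ∀ t ∈ Icc (0 : ℝ) 1, ∀ b, noisyAct θ ω n t z.1 b ≤ B z.1
  let F : Vec (h 0) × Vec (h d) → Fin (h (n + 1)) → ℝ → Set (Fin (h n) → Bool) := fun z a t =>
    {η | lam * (rowNorm θ n a * B z.1) <
      |∑ b, dropNoise (η b) * (weight θ n a b * noisyAct θ ω n t z.1 b)|}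
  have hsub : {η | Function.update ω ⟨n, hn⟩ η ∈ badEvent θ S hn B lam} ⊆
      {η | (h n : ℝ) < ∑ b, dropNoise (η b)} ∪
        ⋃ z ∈ S', ⋃ a ∈ (Finset.univ : Finset (Fin (h (n + 1)))),
          ⋃ t ∈ (T z).filter (· ∈ Icc (0 : ℝ) 1), F z a t := by
    intro η hη
    simp only [badEvent, layerNoise, mem_ofPred_eq, hact, Function.update_self] at hη
    rcases hη with hη | ⟨z, hz, hbd, t, ht, a, hlt⟩
    · exact Or.inl hη
    · right
      obtain ⟨t', ht', htI, hb⟩ := hT z hz hbd t ht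
      simp only [mem_iUnion]
      refine ⟨z, Finset.mem_filter.2 ⟨hz, hbd⟩, a, Finset.mem_univ _, t',
        Finset.mem_filter.2 ⟨ht', htI⟩, ?_⟩
      have := abs_layerNoise_sub_le θ hh a η hb
      show lam * _ < _
      linarith
  refine (measureReal_mono hsub).trans ((measureReal_union_le _ _).trans (add_le_add ?_ ?_))
  · have := maskLaw_lt_sum_le (n := h n) (fun _ => 1) (σ := Real.sqrt (h n))
      (lam := Real.sqrt (h n)) (Real.sqrt_nonneg _) (Real.sqrt_nonneg _) (by simp)
    simpa using this
  · have hF : ∀ z ∈ S', ∀ a, ∀ t ∈ (T z).filter (· ∈ Icc (0 : ℝ) 1),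
        (maskLaw (h n)).real (F z a t) ≤ 2 * Real.exp (-lam ^ 2 / 8) := by
      intro z hz a t ht
      have hz := Finset.mem_filter.1 hz
      have hr := rowNorm_nonneg θ n a
      have hBz := (hB z hz.1).le
      refine maskLaw_lt_abs_sum_le _ (mul_nonneg hr hBz) hlam ?_
      rw [mul_pow, sq_rowNorm, Finset.sum_mul]
      refine Finset.sum_le_sum fun b _ => ?_
      rw [mul_pow]
      exact mul_le_mul_of_nonneg_left
        (pow_le_pow_left₀ (noisyAct_nonneg _ _ hn1 _ _ _) (hz.2 t (Finset.mem_filter.1 ht).2 b) 2)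
        (sq_nonneg _)
    set D := 2 * Real.exp (-lam ^ 2 / 8) with hD
    have hD0 : 0 ≤ D := by positivity
    have h3 : ∀ z ∈ S', ∀ a ∈ (Finset.univ : Finset (Fin (h (n + 1)))),
        (maskLaw (h n)).real (⋃ t ∈ (T z).filter (· ∈ Icc (0 : ℝ) 1), F z a t) ≤ M * D := by
      intro z hz a _
      refine (measureReal_biUnion_finset_le _ _).trans ?_
      refine (Finset.sum_le_card_nsmul _ _ _ (hF z hz a)).trans ?_
      rw [nsmul_eq_mul]
      have : ((T z).filter (· ∈ Icc (0 : ℝ) 1)).card ≤ M :=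
        (Finset.card_filter_le _ _).trans (hTc z (Finset.mem_filter.1 hz).1)
      gcongr
    have h2 : ∀ z ∈ S', (maskLaw (h n)).real (⋃ a ∈ (Finset.univ : Finset (Fin (h (n + 1)))),
        ⋃ t ∈ (T z).filter (· ∈ Icc (0 : ℝ) 1), F z a t) ≤ h (n + 1) * (M * D) := by
      intro z hz
      refine (measureReal_biUnion_finset_le _ _).trans ?_
      refine (Finset.sum_le_card_nsmul _ _ _ (h3 z hz)).trans (le_of_eq ?_)
      rw [nsmul_eq_mul, Finset.card_univ, Fintype.card_fin]
    refine (measureReal_biUnion_finset_le _ _).trans ?_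
    refine (Finset.sum_le_card_nsmul _ _ _ h2).trans ?_
    rw [nsmul_eq_mul]
    have : S'.card ≤ S.card := Finset.card_filter_le _ _
    have e : (S.card : ℝ) * h (n + 1) * M * D = S.card * (h (n + 1) * (M * D)) := by ring
    rw [e]
    gcongr

/-- An event of probability at least `1 / 2` contains an outcome that avoids all the bad events,
provided that their probabilities add up to less than `1 / 2`. -/
theorem exists_mem_notMem_badEvent (θ : Params d h) (S : Finset (Vec (h 0) × Vec (h d)))
    {E : Set (Mask d h)} (hE : 1 / 2 ≤ dropoutLaw d h dropProb E) {B : ℕ → Vec (h 0) → ℝ}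
    {lam δ : ℝ} (hδ : d * δ < 1 / 2) (hδ0 : 0 ≤ δ)
    (H : ∀ n (hn : n < d), 1 ≤ n →
      (dropoutLaw d h dropProb).real (badEvent θ S hn (B n) lam) ≤ δ) :
    ∃ ω ∈ E, ∀ n (hn : n < d), 1 ≤ n → ω ∉ badEvent θ S hn (B n) lam := by
  by_contra hcon
  push Not at hcon
  have hsub : E ⊆ ⋃ n ∈ (Finset.univ.filter fun n : Fin d => 1 ≤ n.val),
      badEvent θ S n.2 (B n) lam := by
    intro ω hω
    obtain ⟨n, hn, hn1, hb⟩ := hcon ω hω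
    simp only [mem_iUnion]
    exact ⟨⟨n, hn⟩, Finset.mem_filter.2 ⟨Finset.mem_univ _, hn1⟩, hb⟩
  have : IsProbabilityMeasure (dropoutLaw d h dropProb) := by
    unfold dropoutLaw; infer_instance
  have h1 : (1 / 2 : ℝ) ≤ (dropoutLaw d h dropProb).real E := by
    have := ENNReal.toReal_mono (measure_ne_top _ _) hE
    simpa [Measure.real] using this
  have h2 := (measureReal_mono hsub (measure_ne_top (dropoutLaw d h dropProb) _)).trans
    ((measureReal_biUnion_finset_le _ _).trans (Finset.sum_le_card_nsmul _ _ δ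
      fun n hn => H n n.2 (Finset.mem_filter.1 hn).2))
  rw [nsmul_eq_mul] at h2
  have h3 : (((Finset.univ.filter fun n : Fin d => 1 ≤ n.val).card : ℕ) : ℝ) ≤ d := by
    have := Finset.card_filter_le Finset.univ fun n : Fin d => 1 ≤ n.val
    rw [Finset.card_univ, Fintype.card_fin] at this
    exact_mod_cast this
  nlinarith

/-! ### Norms and homogeneity -/

theorem norm_relu_le {n : ℕ} (v : Vec n) : ‖relu v‖ ≤ ‖v‖ := by
  rw [EuclideanSpace.norm_eq, EuclideanSpace.norm_eq]
  refine Real.sqrt_le_sqrt (Finset.sum_le_sum fun a _ => ?_)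
  refine pow_le_pow_left₀ (norm_nonneg _) ?_ 2
  rw [relu_coord, Real.norm_eq_abs, Real.norm_eq_abs, abs_of_nonneg (le_max_right _ _)]
  exact max_le (le_abs_self _) (abs_nonneg _)

theorem norm_le_frobeniusNorm_mul {m n : ℕ} (A : Matrix (Fin m) (Fin n) ℝ) {D : ℝ} (hD : 0 ≤ D)
    {v : Vec m} (hv : ∀ a, |v a| ≤ Real.sqrt (∑ b, A a b ^ 2) * D) :
    ‖v‖ ≤ frobeniusNorm A * D := by
  have h0 : 0 ≤ ∑ a, ∑ b, A a b ^ 2 :=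
    Finset.sum_nonneg fun _ _ => Finset.sum_nonneg fun _ _ => sq_nonneg _
  rw [EuclideanSpace.norm_eq, frobeniusNorm, ← Real.sqrt_sq hD, ← Real.sqrt_mul h0,
    Finset.sum_mul]
  refine Real.sqrt_le_sqrt (Finset.sum_le_sum fun a _ => ?_)
  rw [Real.norm_eq_abs]
  refine (pow_le_pow_left₀ (abs_nonneg _) (hv a) 2).trans (le_of_eq ?_)
  rw [mul_pow, Real.sq_sqrt (Finset.sum_nonneg fun _ _ => sq_nonneg _)]

theorem norm_apply_le {m n : ℕ} (A : Matrix (Fin m) (Fin n) ℝ) (v : Vec n) :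
    ‖apply A v‖ ≤ frobeniusNorm A * ‖v‖ := by
  refine norm_le_frobeniusNorm_mul A (norm_nonneg v) fun a => ?_
  rw [apply_coord, ← Real.sqrt_sq_eq_abs, EuclideanSpace.norm_eq, ← Real.sqrt_mul
    (Finset.sum_nonneg fun _ _ => sq_nonneg _)]
  refine Real.sqrt_le_sqrt ((Finset.sum_mul_sq_le_sq_mul_sq _ _ _).trans (le_of_eq ?_))
  simp

theorem frobeniusNorm_nonneg {m n : ℕ} (A : Matrix (Fin m) (Fin n) ℝ) : 0 ≤ frobeniusNorm A :=
  Real.sqrt_nonneg _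

theorem apply_smul {m n : ℕ} (A : Matrix (Fin m) (Fin n) ℝ) (s : ℝ) (v : Vec n) :
    apply A (s • v) = s • apply A v := by
  ext a
  simp only [apply_coord, PiLp.smul_apply, smul_eq_mul, Finset.mul_sum]
  exact Finset.sum_congr rfl fun b _ => by ring

theorem relu_smul {n : ℕ} {s : ℝ} (hs : 0 ≤ s) (v : Vec n) : relu (s • v) = s • relu v := by
  ext a
  simp only [relu_coord, PiLp.smul_apply, smul_eq_mul]
  rw [mul_max_of_nonneg _ _ hs, mul_zero]

theorem layers_smul (θ : Params d h) (i k : ℕ) {s : ℝ} (hs : 0 ≤ s) (v : Vec (h i)) :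
    layers θ i k (s • v) = s • layers θ i k v := by
  induction k with
  | zero => rfl
  | succ k ih =>
    show apply _ (relu (layers θ i k (s • v))) = s • apply _ (relu (layers θ i k v))
    rw [ih, relu_smul hs, apply_smul]

/-- Euler's identity for positively homogeneous maps. -/
theorem fderiv_apply_self_of_homogeneous {E F : Type*} [NormedAddCommGroup E] [NormedSpace ℝ E]
    [NormedAddCommGroup F] [NormedSpace ℝ F] {f : E → F} {x : E}
    (hf : ∀ s : ℝ, 0 ≤ s → f (s • x) = s • f x) (hd : DifferentiableAt ℝ f x) :
    fderiv ℝ f x x = f x := by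
  have h1 : HasDerivAt (fun s : ℝ => s • x) x 1 := by
    simpa using (hasDerivAt_id (1 : ℝ)).smul_const x
  have h2 : HasDerivAt (fun s : ℝ => f (s • x)) (fderiv ℝ f x x) 1 := by
    have hx : HasFDerivAt f (fderiv ℝ f x) ((1 : ℝ) • x) := by
      rw [one_smul]; exact hd.hasFDerivAt
    exact hx.comp_hasDerivAt 1 h1
  have h3 : HasDerivAt (fun s : ℝ => f (s • x)) (f x) 1 := by
    have : HasDerivAt (fun s : ℝ => s • f x) (f x) 1 := by
      simpa using (hasDerivAt_id (1 : ℝ)).smul_const (f x)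
    refine this.congr_of_eventuallyEq ?_
    filter_upwards [lt_mem_nhds (zero_lt_one' ℝ)] with s hs
    exact hf s hs.le
  exact h2.unique h3

/-- The layers above `i` of a network that agrees there with `θ`. -/
theorem preact_eq_layers {θ ψ : Params d h} {i : ℕ} (hi : 1 ≤ i)
    (H : ∀ n, i ≤ n → weight ψ n = weight θ n) (x : Vec (h 0)) (k : ℕ) :
    preact ψ x (i + k) = layers θ i k (preact ψ x i) := by
  induction k with
  | zero => rfl
  | succ k ih =>
    show preact ψ x ((i + k) + 1) = apply (weight θ (i + k)) (relu (layers θ i k (preact ψ x i)))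
    rw [preact_succ, layerInput_of_pos _ _ (by omega), ih, H _ (by omega)]

/-! ### Consequences of positive cushions -/

section Cushion

variable {θ : Params d h} {S : Finset (Vec (h 0) × Vec (h d))}

theorem layerCushion_nonneg (n : ℕ) : 0 ≤ layerCushion θ S n :=
  Real.iInf_nonneg fun _ => div_nonneg (norm_nonneg _)
    (mul_nonneg (frobeniusNorm_nonneg _) (norm_nonneg _))

theorem minInterlayerCushion_nonneg (i : ℕ) : 0 ≤ minInterlayerCushion θ S i :=
  Real.iInf_nonneg fun _ => Real.iInf_nonneg fun _ => by positivity

theorem minCushion_le {n : ℕ} (hn1 : 1 ≤ n) (hn : n < d) :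
    minCushion θ S ≤ layerCushion θ S n * minInterlayerCushion θ S (n + 1) := by
  have := ciInf_le (Set.finite_range fun m : Fin (d - 1) =>
    layerCushion θ S (m.val + 1) * minInterlayerCushion θ S (m.val + 2)).bddBelow ⟨n - 1, by omega⟩
  obtain ⟨n, rfl⟩ := Nat.exists_eq_add_of_le' hn1
  exact this

theorem layerCushion_pos (hc : 0 < minCushion θ S) {n : ℕ} (hn1 : 1 ≤ n) (hn : n < d) :
    0 < layerCushion θ S n :=
  pos_of_mul_pos_left (hc.trans_le (minCushion_le hn1 hn)) (minInterlayerCushion_nonneg _)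

theorem minInterlayerCushion_pos (hc : 0 < minCushion θ S) {n : ℕ} (hn1 : 1 ≤ n) (hn : n < d) :
    0 < minInterlayerCushion θ S (n + 1) :=
  pos_of_mul_pos_right (hc.trans_le (minCushion_le hn1 hn)) (layerCushion_nonneg _)

theorem layerCushion_le_div {z : Vec (h 0) × Vec (h d)} (hz : z ∈ S) {n : ℕ} (hn1 : 1 ≤ n) :
    layerCushion θ S n ≤ ‖preact θ z.1 (n + 1)‖ /
      (frobeniusNorm (weight θ n) * ‖relu (preact θ z.1 n)‖) := by
  rw [preact_succ, layerInput_of_pos _ _ hn1]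
  exact ciInf_le (Set.finite_range fun z : S => ‖apply (weight θ n) (relu (preact θ z.1.1 n))‖ /
    (frobeniusNorm (weight θ n) * ‖relu (preact θ z.1.1 n)‖)).bddBelow ⟨z, hz⟩

theorem layerCushion_le_one (hS : S.Nonempty) {n : ℕ} (hn1 : 1 ≤ n) : layerCushion θ S n ≤ 1 := by
  obtain ⟨z, hz⟩ := hS
  refine (layerCushion_le_div hz hn1).trans (div_le_one_of_le₀ ?_
    (mul_nonneg (frobeniusNorm_nonneg _) (norm_nonneg _)))
  rw [preact_succ, layerInput_of_pos _ _ hn1]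
  exact norm_apply_le _ _

theorem minInterlayerCushion_le_div {z : Vec (h 0) × Vec (h d)} (hz : z ∈ S) {i k : ℕ}
    (hk : i + k ≤ d) :
    minInterlayerCushion θ S i ≤ ‖jacobian θ z.1 i k (preact θ z.1 i)‖ /
      (‖jacobian θ z.1 i k‖ * ‖preact θ z.1 i‖) := by
  refine (ciInf_le (Set.finite_range fun k : Fin (d - i + 1) =>
    interlayerCushion θ S i k.val).bddBelow ⟨k, by omega⟩).trans ?_
  exact ciInf_le (Set.finite_range fun z : S => ‖jacobian θ z.1.1 i k (preact θ z.1.1 i)‖ /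
    (‖jacobian θ z.1.1 i k‖ * ‖preact θ z.1.1 i‖)).bddBelow ⟨z, hz⟩

theorem minInterlayerCushion_le_one (hS : S.Nonempty) {i : ℕ} (hi : i ≤ d) :
    minInterlayerCushion θ S i ≤ 1 := by
  obtain ⟨z, hz⟩ := hS
  exact (minInterlayerCushion_le_div (k := 0) hz hi).trans (div_le_one_of_le₀
    (ContinuousLinearMap.le_opNorm _ _) (by positivity))

theorem minCushion_le_one (hd : 2 ≤ d) (hS : S.Nonempty) : minCushion θ S ≤ 1 :=
  (minCushion_le le_rfl hd).trans (mul_le_one₀ (layerCushion_le_one hS le_rfl)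
    (minInterlayerCushion_nonneg _) (minInterlayerCushion_le_one hS hd))

/-- Division by zero gives zero, so a vanishing denominator would contradict the positive cushion.
-/
theorem norm_relu_preact_pos (hc : 0 < minCushion θ S) {z : Vec (h 0) × Vec (h d)} (hz : z ∈ S)
    {n : ℕ} (hn1 : 1 ≤ n) (hn : n < d) : 0 < ‖relu (preact θ z.1 n)‖ := by
  have h1 := (layerCushion_pos hc hn1 hn).trans_le (layerCushion_le_div hz hn1)
  refine (norm_nonneg _).lt_of_ne' fun h0 => ?_
  rw [h0, mul_zero, div_zero] at h1
  exact h1.false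

theorem norm_preact_pos (hc : 0 < minCushion θ S) (hd : 2 ≤ d) {z : Vec (h 0) × Vec (h d)}
    (hz : z ∈ S) {n : ℕ} (hn1 : 1 ≤ n) (hn : n ≤ d) : 0 < ‖preact θ z.1 n‖ := by
  rcases hn.lt_or_eq with hn | rfl
  · exact (norm_relu_preact_pos hc hz hn1 hn).trans_le (norm_relu_le _)
  · obtain ⟨n, rfl⟩ := Nat.exists_eq_add_of_le' hn1
    have h1 := (layerCushion_pos hc (n := n) (by omega) (by omega)).trans_le
      (layerCushion_le_div hz (by omega))
    refine (norm_nonneg _).lt_of_ne' fun h0 => ?_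
    rw [h0, zero_div] at h1
    exact h1.false

theorem layerCushion_mul_le (hc : 0 < minCushion θ S) {z : Vec (h 0) × Vec (h d)} (hz : z ∈ S)
    {n : ℕ} (hn1 : 1 ≤ n) (hn : n < d) :
    layerCushion θ S n * (frobeniusNorm (weight θ n) * ‖relu (preact θ z.1 n)‖) ≤
      ‖preact θ z.1 (n + 1)‖ := by
  have h1 := layerCushion_le_div (θ := θ) hz hn1
  have h2 : 0 < frobeniusNorm (weight θ n) * ‖relu (preact θ z.1 n)‖ := by
    refine (mul_nonneg (frobeniusNorm_nonneg _) (norm_nonneg _)).lt_of_ne' fun h0 => ?_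
    rw [h0, div_zero] at h1
    exact absurd (layerCushion_pos hc hn1 hn) (not_lt.2 h1)
  exact (le_div_iff₀ h2).1 h1

/-- The Jacobians between layers are bounded in terms of the interlayer cushion. -/
theorem norm_jacobian_mul_le (hc : 0 < minCushion θ S) {z : Vec (h 0) × Vec (h d)} (hz : z ∈ S)
    {n k : ℕ} (hn1 : 1 ≤ n) (hk : n + 1 + k ≤ d) :
    minInterlayerCushion θ S (n + 1) * (‖jacobian θ z.1 (n + 1) k‖ * ‖preact θ z.1 (n + 1)‖) ≤
      ‖preact θ z.1 (n + 1 + k)‖ := by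
  have h1 := minInterlayerCushion_le_div (θ := θ) hz hk
  have hpos := minInterlayerCushion_pos hc hn1 (by omega)
  have h2 : 0 < ‖jacobian θ z.1 (n + 1) k‖ * ‖preact θ z.1 (n + 1)‖ := by
    refine (by positivity : (0 : ℝ) ≤ _).lt_of_ne' fun h0 => ?_
    rw [h0, div_zero] at h1
    exact absurd hpos (not_lt.2 h1)
  -- `fderiv` is zero where there is no derivative, which would make the cushion zero.
  have hdiff : DifferentiableAt ℝ (layers θ (n + 1) k) (preact θ z.1 (n + 1)) := by
    by_contra hnd
    rw [jacobian, fderiv_zero_of_not_differentiableAt hnd, norm_zero, zero_mul] at h2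
    exact h2.false
  -- The layers are positively homogeneous, so by Euler's identity the numerator of the cushion is
  -- the norm of the later vector before activation.
  have h3 := fderiv_apply_self_of_homogeneous
    (fun s hs => layers_smul θ (n + 1) k hs (preact θ z.1 (n + 1))) hdiff
  rw [← preact_eq_layers (by omega) (fun _ _ => rfl)] at h3
  rw [jacobian, h3] at h1
  exact (le_div_iff₀ h2).1 h1

theorem norm_preact_le_activationContraction_mul (hc : 0 < minCushion θ S)
    {z : Vec (h 0) × Vec (h d)} (hz : z ∈ S) {n : ℕ} (hn1 : 1 ≤ n) (hn : n < d) :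
    ‖preact θ z.1 n‖ ≤ activationContraction θ S * ‖relu (preact θ z.1 n)‖ := by
  rw [← div_le_iff₀ (norm_relu_preact_pos hc hz hn1 hn)]
  have := le_ciSup (Set.finite_range fun q : S × Fin (d - 1) =>
    ‖preact θ q.1.1.1 (q.2.val + 1)‖ / ‖relu (preact θ q.1.1.1 (q.2.val + 1))‖).bddAbove
    (⟨z, hz⟩, ⟨n - 1, by omega⟩)
  obtain ⟨n, rfl⟩ := Nat.exists_eq_add_of_le' hn1
  exact this

theorem one_le_activationContraction (hc : 0 < minCushion θ S) (hd : 2 ≤ d) (hS : S.Nonempty) :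
    1 ≤ activationContraction θ S := by
  obtain ⟨z, hz⟩ := hS
  have h1 := norm_preact_le_activationContraction_mul hc hz le_rfl (by omega)
  have h2 := norm_relu_preact_pos hc hz le_rfl (by omega)
  have h3 := norm_relu_le (preact θ z.1 1)
  by_contra h4
  nlinarith

theorem minWidth_le {n : ℕ} (hn1 : 1 ≤ n) (hn : n < d) : minWidth d h ≤ h n := by
  have := ciInf_le (Set.finite_range fun m : Fin (d - 1) => h (m.val + 1)).bddBelow
    ⟨n - 1, by omega⟩
  obtain ⟨n, rfl⟩ := Nat.exists_eq_add_of_le' hn1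
  exact this

theorem width_pos (hc : 0 < minCushion θ S) (hS : S.Nonempty) {n : ℕ} (hn1 : 1 ≤ n)
    (hn : n < d) : 0 < h n := by
  obtain ⟨z, hz⟩ := hS
  by_contra h0
  have : IsEmpty (Fin (h n)) := by
    rw [Nat.eq_zero_of_not_pos h0]; infer_instance
  have h1 := norm_relu_preact_pos hc hz hn1 hn
  rw [Subsingleton.elim (relu (preact θ z.1 n)) 0, norm_zero] at h1
  exact h1.false

theorem minWidth_pos (hc : 0 < minCushion θ S) (hd : 2 ≤ d) (hS : S.Nonempty) :
    0 < minWidth d h := by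
  have : Nonempty (Fin (d - 1)) := ⟨⟨0, by omega⟩⟩
  obtain ⟨n, hn⟩ := exists_eq_ciInf_of_finite (f := fun n : Fin (d - 1) => h (n.val + 1))
  rw [minWidth, ← hn]
  exact width_pos hc hS (by omega) (by omega)

end Cushion

/-! ### Propagation of the dropout noise -/

theorem weight_dropout_of_le (p : unitInterval) (θ : Params d h) (ω : Mask d h) (t : ℝ) {m n : ℕ}
    (hn : n = 0 ∨ m ≤ n) : weight (t • θ + (1 - t) • dropout p θ ω m) n = weight θ n := by
  have : weight (dropout p θ ω m) n = weight θ n := by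
    unfold weight
    split_ifs with hnd
    · ext a b
      have : ¬ (1 ≤ n ∧ n + 1 ≤ m) := by omega
      simp only [dropout, Matrix.of_apply, if_neg this]
    · rfl
  rw [weight_convexComb, this, ← add_smul, add_sub_cancel, one_smul]

theorem weight_dropout_of_lt (θ : Params d h) (ω : Mask d h) (t : ℝ) {m n : ℕ} (hn : n < d)
    (hn1 : 1 ≤ n) (hm : n < m) (a : Fin (h (n + 1))) (b : Fin (h n)) :
    weight (t • θ + (1 - t) • dropout dropProb θ ω m) n a b =
      weight θ n a b + (1 - t) * (dropNoise (ω ⟨n, hn⟩ b) * weight θ n a b) := by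
  rw [weight_convexComb, Matrix.add_apply, Matrix.smul_apply, Matrix.smul_apply,
    weight_of_lt _ hn, weight_of_lt _ hn]
  have : 1 ≤ n ∧ n + 1 ≤ m := ⟨hn1, hm⟩
  simp only [dropout, Matrix.of_apply, if_pos this, dropNoise, smul_eq_mul]
  cases ω ⟨n, hn⟩ b
  · simp only [Bool.false_eq_true, if_false]; ring
  · simp only [if_true]; ring

theorem noisyAct_eq_relu (θ : Params d h) (ω : Mask d h) {n : ℕ} (hn : 1 ≤ n) (t : ℝ)
    (x : Vec (h 0)) :
    noisyAct θ ω n t x = relu (noisyPreact dropProb θ ω n t x n) :=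
  layerInput_of_pos _ _ hn

theorem noisyPreact_eq_layers (p : unitInterval) (θ : Params d h) (ω : Mask d h) (t : ℝ)
    (x : Vec (h 0)) {m i : ℕ} (hi : 1 ≤ i) (hm : m ≤ i) (k : ℕ) :
    noisyPreact p θ ω m t x (i + k) = layers θ i k (noisyPreact p θ ω m t x i) :=
  preact_eq_layers hi (fun _ hn => weight_dropout_of_le p θ ω t (Or.inr (hm.trans hn))) x k

theorem noisyPreact_one (p : unitInterval) (θ : Params d h) (ω : Mask d h) (t : ℝ)
    (x : Vec (h 0)) (j : ℕ) : noisyPreact p θ ω 1 t x j = preact θ x j :=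
  preact_congr x fun n _ => weight_dropout_of_le p θ ω t (by omega)

/-- Dropping out one more layer changes the vector before activation by the layer noise. -/
theorem noisyPreact_succ_sub_coord (θ : Params d h) (ω : Mask d h) {n : ℕ} (hn1 : 1 ≤ n)
    (hn : n < d) (t : ℝ) (x : Vec (h 0)) (a : Fin (h (n + 1))) :
    (noisyPreact dropProb θ ω (n + 1) t x (n + 1) - noisyPreact dropProb θ ω n t x (n + 1)) a =
      (1 - t) * layerNoise θ ω hn t x a := by
  have e1 : noisyPreact dropProb θ ω (n + 1) t x n = noisyPreact dropProb θ ω n t x n := by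
    refine preact_congr x fun m hm => ?_
    rcases Nat.eq_zero_or_pos m with rfl | hm0
    · rw [weight_dropout_of_le _ _ _ _ (Or.inl rfl), weight_dropout_of_le _ _ _ _ (Or.inl rfl)]
    · ext a b
      rw [weight_dropout_of_lt _ _ _ (by omega) hm0 (by omega),
        weight_dropout_of_lt _ _ _ (by omega) hm0 (by omega)]
  have e2 : layerInput (t • θ + (1 - t) • dropout dropProb θ ω (n + 1)) x n =
      noisyAct θ ω n t x := by
    rw [layerInput_of_pos _ _ hn1, noisyAct_eq_relu _ _ hn1]
    exact congrArg relu e1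
  unfold noisyPreact
  rw [preact_succ, preact_succ, e2, weight_dropout_of_le _ _ _ _ (Or.inr le_rfl), PiLp.sub_apply,
    apply_coord, apply_coord, ← Finset.sum_sub_distrib, layerNoise, Finset.mul_sum]
  refine Finset.sum_congr rfl fun b _ => ?_
  rw [weight_dropout_of_lt _ _ _ hn hn1 n.lt_succ_self]
  show _ - _ * noisyAct θ ω n t x b = _
  ring

/-- The bound on the activations used in the concentration argument. -/
noncomputable def actBound (K : ℝ) (θ : Params d h) (n : ℕ) (x : Vec (h 0)) : ℝ :=
  K / Real.sqrt (h n) * (2 * ‖preact θ x n‖)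

/-- The relative size of the noise that the dropout of one layer causes. -/
noncomputable def relNoise (K lam : ℝ) (θ : Params d h) (S : Finset (Vec (h 0) × Vec (h d))) : ℝ :=
  2 * (lam + 3) * K * activationContraction θ S /
    (Real.sqrt (minWidth d h) * minCushion θ S)

section Propagation

variable {θ : Params d h} {S : Finset (Vec (h 0) × Vec (h d))} {K lam : ℝ}

theorem relNoise_nonneg (hc : 0 < minCushion θ S) (hd : 2 ≤ d) (hS : S.Nonempty) (hK : 0 ≤ K)
    (hlam : 0 ≤ lam) : 0 ≤ relNoise K lam θ S := by
  have := one_le_activationContraction hc hd hS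
  unfold relNoise
  positivity

/-- The bounds on the units add up to a Frobenius norm times `actBound`, and the layer cushion
converts this into a multiple of the norm of the next vector. The factor `minInterlayerCushion` is
split off to absorb the Jacobian of the later layers. -/
theorem norm_noise_le (hc : 0 < minCushion θ S) (hd : 2 ≤ d) (hK : 0 < K) (hlam : 0 ≤ lam)
    {ω : Mask d h} {n : ℕ} (hn1 : 1 ≤ n) (hn : n < d)
    (hω : ω ∉ badEvent θ S hn (actBound K θ n) lam) {z : Vec (h 0) × Vec (h d)} (hz : z ∈ S)
    (hbd : ∀ t ∈ Icc (0 : ℝ) 1, ∀ b, noisyAct θ ω n t z.1 b ≤ actBound K θ n z.1)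
    {t : ℝ} (ht : t ∈ Icc (0 : ℝ) 1) :
    ‖noisyPreact dropProb θ ω (n + 1) t z.1 (n + 1) - noisyPreact dropProb θ ω n t z.1 (n + 1)‖ ≤
      relNoise K lam θ S * minInterlayerCushion θ S (n + 1) * ‖preact θ z.1 (n + 1)‖ := by
  have hS : S.Nonempty := ⟨z, hz⟩
  have hw : (0 : ℝ) < minWidth d h := by exact_mod_cast minWidth_pos hc hd hS
  have hwn : (minWidth d h : ℝ) ≤ h n := by exact_mod_cast minWidth_le hn1 hn
  have hB : 0 ≤ actBound K θ n z.1 := by unfold actBound; positivity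
  have hnoise : ∀ a, |layerNoise θ ω hn t z.1 a| ≤
      (lam + 3) * (rowNorm θ n a * actBound K θ n z.1) := by
    intro a
    by_contra hlt
    exact hω (Or.inr ⟨z, hz, hbd, t, ht, a, not_le.1 hlt⟩)
  have h1 : ‖noisyPreact dropProb θ ω (n + 1) t z.1 (n + 1) -
      noisyPreact dropProb θ ω n t z.1 (n + 1)‖ ≤
      frobeniusNorm (weight θ n) * ((lam + 3) * actBound K θ n z.1) := by
    refine norm_le_frobeniusNorm_mul _ (by positivity) fun a => ?_
    rw [noisyPreact_succ_sub_coord θ ω hn1 hn, abs_mul]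
    calc |1 - t| * |layerNoise θ ω hn t z.1 a|
        ≤ 1 * ((lam + 3) * (rowNorm θ n a * actBound K θ n z.1)) :=
          mul_le_mul (abs_le.2 ⟨by linarith [ht.2], by linarith [ht.1]⟩) (hnoise a)
            (abs_nonneg _) zero_le_one
      _ = rowNorm θ n a * ((lam + 3) * actBound K θ n z.1) := by ring
  refine h1.trans ?_
  set A := frobeniusNorm (weight θ n)
  set c := activationContraction θ S
  set R := ‖relu (preact θ z.1 n)‖
  set μl := layerCushion θ S n with hμl
  set μi := minInterlayerCushion θ S (n + 1) with hμi
  have hA : 0 ≤ A := frobeniusNorm_nonneg _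
  have hcc : 1 ≤ c := one_le_activationContraction hc hd hS
  have hμl0 : 0 < μl := layerCushion_pos hc hn1 hn
  have hμi0 : 0 < μi := minInterlayerCushion_pos hc hn1 hn
  have hmin : minCushion θ S ≤ μl * μi := minCushion_le hn1 hn
  have h2 : ‖preact θ z.1 n‖ ≤ c * R := norm_preact_le_activationContraction_mul hc hz hn1 hn
  have h3 : μl * (A * R) ≤ ‖preact θ z.1 (n + 1)‖ := layerCushion_mul_le hc hz hn1 hn
  have hs : Real.sqrt (minWidth d h) ≤ Real.sqrt (h n) := Real.sqrt_le_sqrt hwn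
  have hs0 : 0 < Real.sqrt (minWidth d h) := Real.sqrt_pos.2 hw
  calc A * ((lam + 3) * actBound K θ n z.1)
      ≤ A * ((lam + 3) * (K / Real.sqrt (minWidth d h) * (2 * (c * R)))) := by
        unfold actBound
        gcongr
    _ = 2 * (lam + 3) * K * c / Real.sqrt (minWidth d h) * (A * R) := by ring
    _ ≤ 2 * (lam + 3) * K * c / Real.sqrt (minWidth d h) * (‖preact θ z.1 (n + 1)‖ / μl) := by
        gcongr
        rw [le_div_iff₀ hμl0]
        linarith
    _ = 2 * (lam + 3) * K * c / (Real.sqrt (minWidth d h) * (μl * μi)) * μi *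
          ‖preact θ z.1 (n + 1)‖ := by
        field_simp
    _ ≤ relNoise K lam θ S * μi * ‖preact θ z.1 (n + 1)‖ := by
        unfold relNoise
        gcongr

/-- One more layer of dropout changes the vectors before activation of the later layers only by a
small relative amount. -/
theorem norm_noisyPreact_succ_sub_le (hc : 0 < minCushion θ S) (hd : 2 ≤ d) {γ δ ρ : ℝ}
    (hγ : 0 ≤ γ) (hδ : 0 ≤ δ) (hρ : 3 * (d : ℝ) ≤ ρ) {ω : Mask d h}
    (hω : ω ∈ smoothEvent dropProb θ S ρ) {n k : ℕ} (hn1 : 1 ≤ n) (hk : n + 1 + k ≤ d)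
    {z : Vec (h 0) × Vec (h d)} (hz : z ∈ S) {t : ℝ} (ht : t ∈ Icc (0 : ℝ) 1)
    (hnoise : ‖noisyPreact dropProb θ ω (n + 1) t z.1 (n + 1) -
      noisyPreact dropProb θ ω n t z.1 (n + 1)‖ ≤
        γ * minInterlayerCushion θ S (n + 1) * ‖preact θ z.1 (n + 1)‖)
    (hclose : ‖noisyPreact dropProb θ ω (n + 1) t z.1 (n + 1) - preact θ z.1 (n + 1)‖ ≤
      δ * ‖preact θ z.1 (n + 1)‖) :
    ‖noisyPreact dropProb θ ω (n + 1) t z.1 (n + 1 + k) -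
      noisyPreact dropProb θ ω n t z.1 (n + 1 + k)‖ ≤
        (γ + (2 * δ + γ) / (3 * d)) * ‖preact θ z.1 (n + 1 + k)‖ := by
  have hS : S.Nonempty := ⟨z, hz⟩
  have hd0 : (0 : ℝ) < d := by exact_mod_cast (by omega : 0 < d)
  obtain ⟨s1, s2⟩ := hω (n + 1) k (by omega) hk z hz t ht
  rw [Nat.add_sub_cancel] at s2
  rw [noisyPreact_eq_layers dropProb θ ω t z.1 (by omega : 1 ≤ n + 1) le_rfl,
    noisyPreact_eq_layers dropProb θ ω t z.1 (by omega : 1 ≤ n + 1) n.le_succ]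
  set u := noisyPreact dropProb θ ω (n + 1) t z.1 (n + 1)
  set w := noisyPreact dropProb θ ω n t z.1 (n + 1)
  set X := ‖preact θ z.1 (n + 1)‖ with hX
  set Y := ‖preact θ z.1 (n + 1 + k)‖ with hY
  set J := jacobian θ z.1 (n + 1) k
  set μi := minInterlayerCushion θ S (n + 1)
  have hX0 : 0 < X := norm_preact_pos hc hd hz (by omega) (by omega)
  have hμ0 : 0 < μi := minInterlayerCushion_pos hc hn1 (by omega)
  have hμ1 : μi ≤ 1 := minInterlayerCushion_le_one hS (by omega)
  have hJ : μi * (‖J‖ * X) ≤ Y := norm_jacobian_mul_le hc hz hn1 hk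
  have hw : ‖w - preact θ z.1 (n + 1)‖ ≤ (δ + γ) * X := by
    have e : w - preact θ z.1 (n + 1) = (u - preact θ z.1 (n + 1)) - (u - w) := by abel
    rw [e]
    refine (norm_sub_le _ _).trans ?_
    have : γ * μi * X ≤ γ * X := by
      rw [mul_assoc]
      exact mul_le_mul_of_nonneg_left (by nlinarith) hγ
    linarith
  have hsm : ∀ {v : Vec (h (n + 1))} {κ : ℝ}, 0 ≤ κ → ‖v - preact θ z.1 (n + 1)‖ ≤ κ * X →
      ‖v - preact θ z.1 (n + 1)‖ * Y / (ρ * X) ≤ κ / (3 * d) * Y := by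
    intro v κ hκ hv
    have hρ0 : 0 < ρ := by linarith
    calc ‖v - preact θ z.1 (n + 1)‖ * Y / (ρ * X) ≤ κ * X * Y / (ρ * X) := by gcongr
      _ = κ / ρ * Y := by field_simp
      _ ≤ κ / (3 * d) * Y := by gcongr
  have b1 := s1.trans (hsm hδ hclose)
  have b2 := s2.trans (hsm (by positivity) hw)
  have b3 : ‖J (u - w)‖ ≤ γ * Y := by
    refine (J.le_opNorm _).trans ?_
    calc ‖J‖ * ‖u - w‖ ≤ ‖J‖ * (γ * μi * X) := by gcongr
      _ = γ * (μi * (‖J‖ * X)) := by ring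
      _ ≤ γ * Y := by gcongr
  -- Two linearization errors, each with a factor `1 / ρ ≤ 1 / (3 * d)`, and a linear part in which
  -- the interlayer cushion compensates for the norm of `J`.
  have e : layers θ (n + 1) k u - layers θ (n + 1) k w =
      (layers θ (n + 1) k u - J u) - (layers θ (n + 1) k w - J w) + J (u - w) := by
    rw [map_sub]; abel
  rw [e]
  refine (norm_add_le _ _).trans ((add_le_add_left (norm_sub_le _ _) _).trans ?_)
  have e2 : (γ + (2 * δ + γ) / (3 * d)) * Y =
      δ / (3 * d) * Y + (δ + γ) / (3 * d) * Y + γ * Y := by ring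
  rw [e2]
  exact add_le_add (add_le_add b1 b2) b3

/-- Outside of the bad events the dropout procedure changes the vectors before activation only by a
small relative amount. -/
theorem norm_noisyPreact_sub_le (hc : 0 < minCushion θ S) (hd : 2 ≤ d) {K' ρ : ℝ} (hK : 0 < K)
    (hK' : K' ≤ K) (hlam : 0 ≤ lam) (hsmall : 4 * d * relNoise K lam θ S ≤ 1)
    (hρ : 3 * (d : ℝ) ≤ ρ) {ω : Mask d h} (hω : ω ∈ smoothEvent dropProb θ S ρ)
    (hω' : ω ∈ spreadEvent dropProb θ S K')
    (hbad : ∀ n (hn : n < d), 1 ≤ n → ω ∉ badEvent θ S hn (actBound K θ n) lam)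
    {z : Vec (h 0) × Vec (h d)} (hz : z ∈ S) {j : ℕ} (hj1 : 1 ≤ j) (hj : j ≤ d) :
    ∀ t ∈ Icc (0 : ℝ) 1, ‖noisyPreact dropProb θ ω j t z.1 j - preact θ z.1 j‖ ≤
      4 * d * relNoise K lam θ S * ‖preact θ z.1 j‖ := by
  have hS : S.Nonempty := ⟨z, hz⟩
  have hd0 : (0 : ℝ) < d := by exact_mod_cast (by omega : 0 < d)
  set γ := relNoise K lam θ S with hγdef
  have hγ : 0 ≤ γ := relNoise_nonneg hc hd hS hK.le hlam
  induction j using Nat.strong_induction_on with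
  | _ j ih =>
  have hnoise : ∀ n, 1 ≤ n → n < j → ∀ t ∈ Icc (0 : ℝ) 1,
      ‖noisyPreact dropProb θ ω (n + 1) t z.1 (n + 1) -
        noisyPreact dropProb θ ω n t z.1 (n + 1)‖ ≤
          γ * minInterlayerCushion θ S (n + 1) * ‖preact θ z.1 (n + 1)‖ := by
    intro n hn1 hn t ht
    refine norm_noise_le hc hd hK hlam hn1 (by omega) (hbad n (by omega) hn1) hz ?_ ht
    intro t ht b
    rw [noisyAct_eq_relu _ _ hn1]
    have h1 := hω' n hn1 (by omega) z hz t ht b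
    have h2 := ih n hn hn1 (by omega) t ht
    -- By induction and `hsmall` the relative error so far is at most one; this is the `2` in
    -- `actBound`.
    have h3 : ‖noisyPreact dropProb θ ω n t z.1 n‖ ≤ 2 * ‖preact θ z.1 n‖ := by
      have e := norm_le_norm_add_norm_sub' (noisyPreact dropProb θ ω n t z.1 n) (preact θ z.1 n)
      nlinarith [norm_nonneg (preact θ z.1 n)]
    refine (le_abs_self _).trans (h1.trans ?_)
    unfold actBound
    exact mul_le_mul (by gcongr) ((norm_relu_le _).trans h3) (norm_nonneg _) (by positivity)
  intro t ht
  -- The layers are dropped out one at a time, beginning with no dropout at all.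
  have htel : noisyPreact dropProb θ ω j t z.1 j - preact θ z.1 j =
      ∑ n ∈ Finset.Ico 1 j, (noisyPreact dropProb θ ω (n + 1) t z.1 j -
        noisyPreact dropProb θ ω n t z.1 j) := by
    rw [Finset.sum_Ico_sub (fun n => noisyPreact dropProb θ ω n t z.1 j) hj1, noisyPreact_one]
  set q := γ + (2 * (4 * d * γ) + γ) / (3 * d) with hq
  have hterm : ∀ n ∈ Finset.Ico 1 j, ‖noisyPreact dropProb θ ω (n + 1) t z.1 j -
      noisyPreact dropProb θ ω n t z.1 j‖ ≤ q * ‖preact θ z.1 j‖ := by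
    intro n hn
    obtain ⟨hn1, hn⟩ := Finset.mem_Ico.1 hn
    -- For `n + 1 = j` the induction hypothesis is not available, but the noise has no further
    -- layers to pass and its bound applies directly.
    rcases (show n + 1 ≤ j from hn).eq_or_lt with rfl | hlt
    · refine (hnoise n hn1 hn t ht).trans ?_
      have hμ1 : minInterlayerCushion θ S (n + 1) ≤ 1 := minInterlayerCushion_le_one hS hj
      have h1 : γ * minInterlayerCushion θ S (n + 1) ≤ γ * 1 := by gcongr
      have h2 : 0 ≤ (2 * (4 * d * γ) + γ) / (3 * d) := by positivity
      gcongr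
      linarith
    · obtain ⟨k, rfl⟩ := Nat.exists_eq_add_of_le hlt.le
      exact norm_noisyPreact_succ_sub_le hc hd hγ (by positivity) hρ hω hn1 hj hz ht
        (hnoise n hn1 hn t ht) (ih (n + 1) hlt (by omega) (by omega) t ht)
  rw [htel]
  refine (norm_sum_le _ _).trans ((Finset.sum_le_card_nsmul _ _ _ hterm).trans ?_)
  rw [Nat.card_Ico, nsmul_eq_mul, ← mul_assoc]
  refine mul_le_mul_of_nonneg_right ?_ (norm_nonneg _)
  have hcard : ((j - 1 : ℕ) : ℝ) ≤ d := by exact_mod_cast (by omega : j - 1 ≤ d)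
  have hq0 : 0 ≤ q := by positivity
  -- The induction closes since `1 + 8/3 + 1/3 = 4`; this is what `ρ ≥ 3 * d` is for.
  calc ((j - 1 : ℕ) : ℝ) * q ≤ d * q := by gcongr
    _ = d * γ + 8 / 3 * d * γ + γ / 3 := by rw [hq]; field_simp; ring
    _ ≤ 4 * d * γ := by
      have : (2 : ℝ) ≤ d := by exact_mod_cast hd
      nlinarith

end Propagation

/-! ### Connecting a noise stable network to one with few alive units -/

/-- The number in the logarithmic factor. -/
def sizeNumber (d : ℕ) (h : ℕ → ℕ) (N : ℕ) : ℕ := 2 + N + d + ∑ i ∈ Finset.Icc 1 d, h i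

theorem logFactor_eq (N : ℕ) : logFactor d h N = Real.log (sizeNumber d h N) := by
  unfold logFactor sizeNumber
  push_cast
  rfl

theorem width_le_sizeNumber {N n : ℕ} (hn1 : 1 ≤ n) (hn : n ≤ d) :
    2 + N + d + h n ≤ sizeNumber d h N := by
  have := Finset.single_le_sum (f := h) (fun _ _ => Nat.zero_le _) (Finset.mem_Icc.2 ⟨hn1, hn⟩)
  unfold sizeNumber
  omega

theorem one_le_logFactor (hd : 2 ≤ d) {N : ℕ} (hN : 1 ≤ N) : 1 ≤ logFactor d h N := by
  have h1 : 5 ≤ sizeNumber d h N := by unfold sizeNumber; omega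
  have h2 : (5 : ℝ) ≤ sizeNumber d h N := by exact_mod_cast h1
  rw [logFactor_eq, Real.le_log_iff_exp_le (by linarith)]
  linarith [Real.exp_one_lt_d9]

/-- The deviation, in units of the standard deviation, that the noise does not exceed. -/
noncomputable def deviation (d : ℕ) (h : ℕ → ℕ) (N : ℕ) : ℝ := Real.sqrt (80 * d * logFactor d h N)

theorem deviation_nonneg (d : ℕ) (h : ℕ → ℕ) (N : ℕ) : 0 ≤ deviation d h N := Real.sqrt_nonneg _

/-- As the logarithm is at least one, `√80 ≤ 9` bounds the first summand, and `9 + 3 = 12`. -/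
theorem deviation_add_le (hd : 2 ≤ d) {N : ℕ} (hN : 1 ≤ N) :
    deviation d h N + 3 ≤ 12 * (Real.sqrt d * logFactor d h N) := by
  have hL := one_le_logFactor (h := h) hd hN
  have hd1 : 1 ≤ Real.sqrt d := Real.one_le_sqrt.2 (by exact_mod_cast (by omega : 1 ≤ d))
  have h1 : deviation d h N ≤ 9 * (Real.sqrt d * logFactor d h N) := by
    refine Real.sqrt_le_iff.2 ⟨by positivity, ?_⟩
    rw [mul_pow, mul_pow, Real.sq_sqrt (Nat.cast_nonneg d)]
    have hd0 : (0 : ℝ) ≤ d := Nat.cast_nonneg d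
    nlinarith [mul_nonneg hd0 (sub_nonneg.2 hL), mul_nonneg (mul_nonneg hd0 (sub_nonneg.2 hL))
      (by linarith : 0 ≤ logFactor d h N)]
  nlinarith

theorem exp_neg_mul_log {N : ℕ} (hN : 0 < N) (k : ℕ) :
    Real.exp (-(k * Real.log N)) = ((N : ℝ) ^ k)⁻¹ := by
  rw [Real.exp_neg, ← Real.log_pow, Real.exp_log (by positivity)]

/-- The constant `80` makes the tail `N ^ (-10 d)`, which beats the net of size `N ^ (2 d)` and the
at most `N ^ 2` pairs of a sample and a unit. The width `24 log N` bounds `exp (-h n / 8)` by `N ^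
(-3)`, small enough to be summed over the layers. -/
theorem measure_badEvent_le_of_width (θ : Params d h) (S : Finset (Vec (h 0) × Vec (h d))) {n : ℕ}
    (hn1 : 1 ≤ n) (hn : n < d) (hh : 24 * logFactor d h S.card ≤ h n) (hh0 : 0 < h n)
    {B : Vec (h 0) → ℝ} (hB : ∀ z ∈ S, 0 < B z.1) :
    (dropoutLaw d h dropProb).real (badEvent θ S hn B (deviation d h S.card)) ≤
      3 * ((sizeNumber d h S.card : ℝ) ^ 3)⁻¹ := by
  set N := sizeNumber d h S.card with hN
  have hN2 : 2 ≤ N := by rw [hN]; unfold sizeNumber; omega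
  have hL : 0 ≤ logFactor d h S.card := by
    rw [logFactor_eq]; exact Real.log_natCast_nonneg _
  have hM : (∏ m ∈ Finset.range (n - 1), (1 + 2 * (h (m + 1) * (m + 1)))) *
      (1 + 2 * (h n * ((h n + 1) * n))) ≤ N ^ (2 * d) := by
    refine (net_card_le hn1 fun m hm1 hm => ?_).trans (Nat.pow_le_pow_right (by omega) (by omega))
    have := width_le_sizeNumber (h := h) (N := S.card) hm1 (by omega : m ≤ d)
    omega
  refine (measure_badEvent_le θ S hn1 hn hh0 hB (deviation_nonneg _ _ _) hM).trans ?_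
  have h1 : Real.exp (-(h n : ℝ) / 8) ≤ ((N : ℝ) ^ 3)⁻¹ := by
    rw [← exp_neg_mul_log (by omega) 3, ← logFactor_eq]
    refine Real.exp_le_exp.2 ?_
    push_cast
    linarith
  have h2 : Real.exp (-deviation d h S.card ^ 2 / 8) = ((N : ℝ) ^ (10 * d))⁻¹ := by
    rw [← exp_neg_mul_log (by omega), ← logFactor_eq, deviation, Real.sq_sqrt (by positivity)]
    congr 1
    push_cast
    ring
  have h3 : (S.card : ℝ) ≤ N := by
    have : S.card ≤ N := by rw [hN]; unfold sizeNumber; omega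
    exact_mod_cast this
  have h4 : (h (n + 1) : ℝ) ≤ N := by
    have := width_le_sizeNumber (h := h) (N := S.card) (by omega : 1 ≤ n + 1) hn
    exact_mod_cast (by omega : h (n + 1) ≤ N)
  have hN0 : (0 : ℝ) < N := by exact_mod_cast (by omega : 0 < N)
  have h5 : (S.card : ℝ) * h (n + 1) * (N ^ (2 * d) : ℕ) *
      (2 * Real.exp (-deviation d h S.card ^ 2 / 8)) ≤ 2 * ((N : ℝ) ^ 3)⁻¹ := by
    rw [h2]
    have hp : (N : ℝ) ^ (2 + 2 * d + 3) ≤ (N : ℝ) ^ (10 * d) :=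
      pow_le_pow_right₀ (by exact_mod_cast (by omega : 1 ≤ N)) (by omega)
    calc (S.card : ℝ) * h (n + 1) * (N ^ (2 * d) : ℕ) * (2 * ((N : ℝ) ^ (10 * d))⁻¹)
        ≤ N * N * (N ^ (2 * d) : ℕ) * (2 * ((N : ℝ) ^ (2 + 2 * d + 3))⁻¹) := by gcongr
      _ = 2 * ((N : ℝ) ^ 3)⁻¹ := by
        push_cast
        rw [pow_add, pow_add]
        field_simp
  linarith

section Half

variable {θ : Params d h} {S : Finset (Vec (h 0) × Vec (h d))}

theorem norm_output_le_maxOutput {z : Vec (h 0) × Vec (h d)} (hz : z ∈ S) :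
    ‖output θ z.1‖ ≤ maxOutput θ S :=
  le_ciSup (Set.finite_range fun z : S => ‖output θ z.1.1‖).bddAbove ⟨z, hz⟩

/-- Deleting the last layer. -/
theorem exists_half_of_zero_output (hd : 2 ≤ d) (θ : Params d h) :
    ∃ (θ' : Params d h) (U : ∀ n, Finset (Fin (h n))), IsHalf d h U ∧
      IsSupportedOn θ' (fun n => ↑(U n)) ∧ ∀ s : ℝ, ∀ x,
        output ((1 - s) • θ + s • θ') x = (1 - s) • output θ x := by
  classical
  let θ' : Params d h := fun n => if n.val + 1 = d then 0 else θ n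
  have w1 : ∀ n, n + 1 < d → weight θ' n = weight θ n := fun n hn => by
    rw [weight_of_lt _ (by omega), weight_of_lt _ (by omega)]
    exact if_neg hn.ne
  have w2 : ∀ n, n + 1 = d → weight θ' n = 0 := fun n hn => by
    rw [weight_of_lt _ (by omega)]
    exact if_pos hn
  refine ⟨θ', fun n => if 1 ≤ n ∧ n < d then ∅ else Finset.univ, ⟨?_, ?_, ?_⟩, ?_, ?_⟩
  · simp
  · simp
  · intro n h1 h2
    simp [h1, h2]
  · intro n hn a ha b _
    rcases (show n + 1 ≤ d from hn).eq_or_lt with h1 | h1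
    · rw [w2 n h1]; rfl
    · simp [h1] at ha
  · intro s x
    have h0 : output θ' x = 0 := by
      obtain ⟨m, rfl⟩ : ∃ m, d = m + 1 := ⟨d - 1, by omega⟩
      unfold output
      rw [preact_succ, w2 m rfl]
      ext a
      rw [apply_coord]
      simp
    rw [output_convexComb (by omega) (fun n hn => (w1 n hn).symm) x (by ring), h0, smul_zero,
      add_zero]

/-- A good outcome of the dropout procedure leaves at most half of the units alive. -/
theorem exists_half_of_dropout (θ : Params d h) {ω : Mask d h}
    (hω : ∀ n (hn : n < d), 1 ≤ n → ∑ b, dropNoise (ω ⟨n, hn⟩ b) ≤ h n) :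
    ∃ U : ∀ n, Finset (Fin (h n)), IsHalf d h U ∧
      IsSupportedOn (dropout dropProb θ ω d) fun n => ↑(U n) := by
  classical
  refine ⟨fun n => if hn : 1 ≤ n ∧ n < d then Finset.univ.filter fun b => ω ⟨n, hn.2⟩ b = false
    else Finset.univ, ⟨?_, ?_, ?_⟩, ?_⟩
  · simp
  · simp
  · intro n h1 h2
    rw [dif_pos ⟨h1, h2⟩]
    have key := hω n h2 h1
    -- Summed over the layer, this is four times the number of alive units minus `h n`; being at
    -- most `h n` means that at most half are alive.
    have e : ∀ b, dropNoise (ω ⟨n, h2⟩ b) = 4 * (if ω ⟨n, h2⟩ b = false then 1 else 0) - 1 := by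
      intro b
      cases ω ⟨n, h2⟩ b <;> norm_num [dropNoise]
    simp only [e, Finset.sum_sub_distrib, ← Finset.mul_sum, Finset.sum_boole, Finset.sum_const,
      Finset.card_univ, Fintype.card_fin, nsmul_eq_mul, mul_one] at key
    have : (2 : ℝ) * (Finset.univ.filter fun b => ω ⟨n, h2⟩ b = false).card ≤ h n := by linarith
    exact_mod_cast this
  · intro n hn a _ b hb
    beta_reduce at hb
    by_cases h1 : 1 ≤ n
    · rw [dif_pos ⟨h1, hn⟩] at hb
      have hb : ω ⟨n, hn⟩ b = true := by simpa using hb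
      have h2 : 1 ≤ n ∧ n + 1 ≤ d := ⟨h1, hn⟩
      rw [weight_of_lt _ hn]
      simp only [dropout, Matrix.of_apply, if_pos h2, hb, if_true, zero_mul]
    · rw [dif_neg (by omega)] at hb
      simp at hb

/-- If the noise is small, there is an outcome of the dropout procedure that leaves at most half of
the units alive and hardly changes the output. -/
theorem exists_half_of_relNoise_le (hc : 0 < minCushion θ S) (hd : 2 ≤ d) (hS : S.Nonempty)
    {K K' ρ : ℝ} (hK : 1 ≤ K) (hK' : K' ≤ K)
    (hsmall : 4 * d * relNoise K (deviation d h S.card) θ S ≤ 1) (hρ : 3 * (d : ℝ) ≤ ρ)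
    (hE : 1 / 2 ≤ dropoutLaw d h dropProb (smoothEvent dropProb θ S ρ ∩
      spreadEvent dropProb θ S K')) :
    ∃ (θ' : Params d h) (U : ∀ n, Finset (Fin (h n))), IsHalf d h U ∧
      IsSupportedOn θ' (fun n => ↑(U n)) ∧ ∀ s ∈ Icc (0 : ℝ) 1, ∀ z ∈ S,
        ‖output ((1 - s) • θ + s • θ') z.1 - output θ z.1‖ ≤
          4 * d * relNoise K (deviation d h S.card) θ S * ‖output θ z.1‖ := by
  set lam := deviation d h S.card with hlamdef
  have hlam : 0 ≤ lam := deviation_nonneg _ _ _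
  have hScard : 1 ≤ S.card := hS.card_pos
  have hL := one_le_logFactor (h := h) hd hScard
  have hw0 := minWidth_pos hc hd hS
  -- The factors `K`, the activation contraction and the inverse cushion are at least one, so small
  -- noise forces wide layers. Hence no assumption on the widths is needed.
  have hw : 8 * d * lam ≤ Real.sqrt (minWidth d h) := by
    have hs0 : 0 < Real.sqrt (minWidth d h) := Real.sqrt_pos.2 (by exact_mod_cast hw0)
    have hcc := one_le_activationContraction hc hd hS
    have hm1 : minCushion θ S ≤ 1 := minCushion_le_one hd hS
    have h1 : 2 * (lam + 3) * 1 * 1 / (Real.sqrt (minWidth d h) * 1) ≤ relNoise K lam θ S := by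
      unfold relNoise
      gcongr
    have h2 := (mul_le_mul_of_nonneg_left h1 (by positivity : (0 : ℝ) ≤ 4 * d)).trans hsmall
    rw [mul_one, mul_one, mul_one, ← mul_div_assoc, div_le_one hs0] at h2
    have : (0 : ℝ) ≤ d := Nat.cast_nonneg d
    nlinarith
  have hwidth : ∀ n, 1 ≤ n → n < d → 24 * logFactor d h S.card ≤ h n := by
    intro n hn1 hn
    have h1 : (minWidth d h : ℝ) ≤ h n := by exact_mod_cast minWidth_le hn1 hn
    have h2 := pow_le_pow_left₀ (by positivity) hw 2
    rw [Real.sq_sqrt (Nat.cast_nonneg _), mul_pow, hlamdef, deviation,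
      Real.sq_sqrt (by positivity)] at h2
    have h3 : (2 : ℝ) ≤ d := by exact_mod_cast hd
    have h4 : (1 : ℝ) ≤ (8 * d) ^ 2 := by nlinarith
    have h5 : 24 * logFactor d h S.card ≤ 80 * d * logFactor d h S.card := by
      gcongr
      linarith
    have h6 : 0 ≤ 80 * d * logFactor d h S.card := by positivity
    nlinarith
  obtain ⟨ω, ⟨hω1, hω2⟩, hbad⟩ := exists_mem_notMem_badEvent θ S hE
    (B := actBound K θ) (lam := lam) (δ := 3 * ((sizeNumber d h S.card : ℝ) ^ 3)⁻¹) (by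
      have h1 : (5 : ℝ) ≤ sizeNumber d h S.card := by
        exact_mod_cast (by unfold sizeNumber; omega : 5 ≤ sizeNumber d h S.card)
      have h2 : (d : ℝ) ≤ sizeNumber d h S.card := by
        exact_mod_cast (by unfold sizeNumber; omega : d ≤ sizeNumber d h S.card)
      have h3 : (0 : ℝ) < sizeNumber d h S.card := by linarith
      rw [← div_eq_mul_inv, ← mul_div_assoc, div_lt_iff₀ (by positivity)]
      nlinarith [mul_pos h3 h3])
    (by positivity) fun n hn hn1 => measure_badEvent_le_of_width θ S hn1 hn (hwidth n hn1 hn)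
      (width_pos hc hS hn1 hn) fun z hz => by
        have h1 := norm_preact_pos hc hd hz hn1 hn.le
        have h2 : (0 : ℝ) < h n := by exact_mod_cast width_pos hc hS hn1 hn
        unfold actBound
        positivity
  obtain ⟨U, hU, hsupp⟩ := exists_half_of_dropout θ (ω := ω) fun n hn hn1 => by
    by_contra hlt
    exact hbad n hn hn1 (Or.inl (not_le.1 hlt))
  refine ⟨_, U, hU, hsupp, fun s hs z hz => ?_⟩
  have := norm_noisyPreact_sub_le hc hd (by linarith) hK' hlam hsmall hρ hω1 hω2 hbad hz
    (by omega : 1 ≤ d) le_rfl (1 - s) ⟨by linarith [hs.2], by linarith [hs.1]⟩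
  unfold noisyPreact at this
  rwa [sub_sub_cancel] at this

/-- A noise stable network is connected by a segment of small loss to a network with at most half of
the units alive. -/
theorem IsNoiseStable.exists_half (hd : 2 ≤ d) (hS : S.Nonempty) {K β ε : ℝ}
    {l : Vec (h d) → Vec (h d) → ℝ} (hl : ∀ y u v, |l y u - l y v| ≤ β * ‖u - v‖)
    (hθ : IsNoiseStable dropProb K β S θ ε) :
    ∃ (θ' : Params d h) (U : ∀ n, Finset (Fin (h n))), IsHalf d h U ∧
      IsSupportedOn θ' (fun n => ↑(U n)) ∧ ∀ s ∈ Icc (0 : ℝ) 1,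
        loss l S ((1 - s) • θ + s • θ') ≤
          loss l S θ + 96 * max K 1 * logFactor d h S.card ^ 1 * ε := by
  have hc := hθ.cushion_pos
  obtain ⟨ρ, hρ, hE⟩ := hθ.smooth
  have hK1 : 1 ≤ max K 1 := le_max_right _ _
  have hScard : 1 ≤ S.card := hS.card_pos
  have hL := one_le_logFactor (h := h) hd hScard
  have hβ : 0 ≤ β := by
    obtain ⟨z, hz⟩ := hS
    have h1 := norm_preact_pos hc hd hz (by omega : 1 ≤ d) le_rfl
    have h2 := (abs_nonneg _).trans (hl 0 (preact θ z.1 d) 0)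
    rw [sub_zero] at h2
    exact nonneg_of_mul_nonneg_left h2 h1
  have hF : 0 ≤ maxOutput θ S := Real.iSup_nonneg fun _ => norm_nonneg _
  set γ := relNoise (max K 1) (deviation d h S.card) θ S with hγ
  have hγ0 : 0 ≤ γ := relNoise_nonneg hc hd hS (by linarith) (deviation_nonneg _ _ _)
  have hbound : β * (4 * d * γ * maxOutput θ S) ≤
      96 * max K 1 * logFactor d h S.card ^ 1 * ε := by
    have hcc := one_le_activationContraction hc hd hS
    have hrp : (d : ℝ) ^ (3 / 2 : ℝ) = d * Real.sqrt d := by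
      have hd0 : (0 : ℝ) < d := by exact_mod_cast (by omega : 0 < d)
      rw [Real.sqrt_eq_rpow, ← Real.rpow_one_add' hd0.le (by norm_num)]
      norm_num
    have hden : 0 ≤ Real.sqrt (minWidth d h) * minCushion θ S := by positivity
    -- `96 = 4 * 2 * 12`, from the telescoping sum, from `relNoise` and from `deviation_add_le`.
    calc β * (4 * d * γ * maxOutput θ S)
        = (deviation d h S.card + 3) * (8 * d * max K 1 * β * activationContraction θ S *
            maxOutput θ S / (Real.sqrt (minWidth d h) * minCushion θ S)) := by
          rw [hγ, relNoise]; ring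
      _ ≤ (12 * (Real.sqrt d * logFactor d h S.card)) * (8 * d * max K 1 * β *
            activationContraction θ S * maxOutput θ S /
              (Real.sqrt (minWidth d h) * minCushion θ S)) :=
          mul_le_mul_of_nonneg_right (deviation_add_le hd hScard) (by positivity)
      _ = 96 * max K 1 * logFactor d h S.card ^ 1 * noiseLevel β θ S := by
          rw [noiseLevel, hrp]; ring
      _ ≤ _ := mul_le_mul_of_nonneg_left hθ.level_le (by positivity)
  suffices H : ∃ (θ' : Params d h) (U : ∀ n, Finset (Fin (h n))), IsHalf d h U ∧
      IsSupportedOn θ' (fun n => ↑(U n)) ∧ ∀ s ∈ Icc (0 : ℝ) 1, ∀ z ∈ S,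
        ‖output ((1 - s) • θ + s • θ') z.1 - output θ z.1‖ ≤ 4 * d * γ * maxOutput θ S by
    obtain ⟨θ', U, hU, hsupp, H⟩ := H
    exact ⟨θ', U, hU, hsupp, fun s hs =>
      (loss_le_add_of_norm_sub_le hS hβ hl (H s hs)).trans (by linarith)⟩
  -- If the permitted error exceeds the size of the output, the output may as well be scaled down to
  -- zero.
  by_cases hsmall : 4 * d * γ ≤ 1
  · obtain ⟨θ', U, hU, hsupp, H⟩ := exists_half_of_relNoise_le hc hd hS hK1 (le_max_left _ _)
      hsmall hρ hE
    refine ⟨θ', U, hU, hsupp, fun s hs z hz => (H s hs z hz).trans ?_⟩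
    exact mul_le_mul_of_nonneg_left (norm_output_le_maxOutput hz) (by positivity)
  · obtain ⟨θ', U, hU, hsupp, H⟩ := exists_half_of_zero_output hd θ
    refine ⟨θ', U, hU, hsupp, fun s hs z hz => ?_⟩
    have e : (1 - s) • output θ z.1 - output θ z.1 = (-s) • output θ z.1 := by module
    rw [H, e, norm_smul, norm_neg, Real.norm_eq_abs, abs_of_nonneg hs.1]
    have h1 := norm_output_le_maxOutput (θ := θ) hz
    exact mul_le_mul (hs.2.trans (not_le.1 hsmall).le) h1 (norm_nonneg _) (by positivity)

end Half

end NoiseStability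

/-! ### Assembling the path -/

theorem theorem2 :
    ∃ k : ℕ, ∀ K : ℝ, ∃ C : ℝ,
      ∀ (d : ℕ) (_ : 2 ≤ d) (h : ℕ → ℕ)
        (S : Finset (NoiseStability.Vec (h 0) × NoiseStability.Vec (h d))) (_ : S.Nonempty)
        (β : ℝ) (l : NoiseStability.Vec (h d) → NoiseStability.Vec (h d) → ℝ)
        (_ : ∀ y, ConvexOn ℝ Set.univ (l y))
        (_ : ∀ y u v, |l y u - l y v| ≤ β * ‖u - v‖)
        (θA θB : NoiseStability.Params d h) (ε : ℝ)
        (_ : NoiseStability.IsNoiseStable ⟨3 / 4, by norm_num, by norm_num⟩ K β S θA ε)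
        (_ : NoiseStability.IsNoiseStable ⟨3 / 4, by norm_num, by norm_num⟩ K β S θB ε),
        ∃ π : ℝ → NoiseStability.Params d h,
          NoiseStability.IsPolygonalPath 10 π θA θB ∧
          ∀ t ∈ Set.Icc (0 : ℝ) 1,
            NoiseStability.loss l S (π t) ≤
              max (NoiseStability.loss l S θA) (NoiseStability.loss l S θB)
                + C * NoiseStability.logFactor d h S.card ^ k * ε := by
  refine ⟨1, fun K => ⟨96 * max K 1, ?_⟩⟩
  intro d hd h S hS β l hconv hlip θA θB ε hA hB
  obtain ⟨A, UA, hUA, hsA, hLA⟩ := hA.exists_half hd hS hlip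
  obtain ⟨B, UB, hUB, hsB, hLB⟩ := hB.exists_half hd hS hlip
  obtain ⟨Q, hQ0, hQ5, hQ⟩ :=
    NoiseStability.exists_path_of_isSupportedOn hd hconv S hUA hUB hsA hsB
  set e := 96 * max K 1 * NoiseStability.logFactor d h S.card ^ 1 * ε
  -- The vertices `0, …, 7` are `θA`, the six vertices of `Q` from `A` to `B`, and `θB`; afterwards
  -- the path rests.
  let P : ℕ → NoiseStability.Params d h := fun m =>
    if m = 0 then θA else if m ≤ 6 then Q (m - 1) else θB
  obtain ⟨π, hπ, hseg⟩ := NoiseStability.exists_polygonalPath (n := 10) (by norm_num) P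
  refine ⟨π, hπ, fun t ht => ?_⟩
  obtain ⟨m, hm, s, hs, hts⟩ := hseg t ht
  rw [hts]
  have hs' : 1 - s ∈ Set.Icc (0 : ℝ) 1 := ⟨by linarith [hs.2], by linarith [hs.1]⟩
  have leA := le_max_left (NoiseStability.loss l S θA) (NoiseStability.loss l S θB)
  have leB := le_max_right (NoiseStability.loss l S θA) (NoiseStability.loss l S θB)
  have hA1 := hLA 1 (by simp)
  have hB1 := hLB 1 (by simp)
  -- At `s = 0` this says `0 ≤ e`, which the constant segments need.
  have hB0 := hLB 0 (by simp)
  simp only [sub_self, zero_smul, zero_add, one_smul, sub_zero, add_zero] at hA1 hB1 hB0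
  rcases Nat.eq_zero_or_pos m with rfl | hm0
  · have : P (0 + 1) = A := hQ0
    rw [this]
    exact (hLA s hs).trans (by linarith)
  obtain ⟨m, rfl⟩ := Nat.exists_eq_add_of_le' hm0
  rcases lt_trichotomy m 5 with hm5 | rfl | hm5
  · have e1 : P (m + 1) = Q m := by
      simp only [P]
      rw [if_neg (by omega), if_pos (by omega), Nat.add_sub_cancel]
    have e2 : P (m + 1 + 1) = Q (m + 1) := by
      simp only [P]
      rw [if_neg (by omega), if_pos (by omega), Nat.add_sub_cancel]
    rw [e1, e2]
    exact (hQ m hm5 s hs).trans (max_le (by linarith) (by linarith))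
  · have e1 : P (5 + 1) = B := hQ5
    have e2 : P (5 + 1 + 1) = θB := rfl
    have := hLB (1 - s) hs'
    rw [sub_sub_cancel] at this
    rw [e1, e2, add_comm]
    linarith
  · have e1 : P (m + 1) = θB := by
      simp only [P]
      rw [if_neg (by omega), if_neg (by omega)]
    have e2 : P (m + 1 + 1) = θB := by
      simp only [P]
      rw [if_neg (by omega), if_neg (by omega)]
    rw [e1, e2, ← add_smul, sub_add_cancel, one_smul]
    linarith
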